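/- Let $n\ge 1$, $m>0$, and use the metric of signature $(+,-,\dots,-)$, so that spatial indices are lowered by $x_j=-x^j$ and $p_kx^k=-\mathbf p\cdot\mathbf x$. Put $\omega_{\mathbf p}=\sqrt{|\mathbf p|^2+m^2}$ and $d^n\mu(\mathbf p)=d^n\mathbf p/(2\omega_{\mathbf p})$. Let $\mathscr F^+$ be the Bosonic Fock space, the Hilbert space direct sum over $k\ge 0$ of the spaces of symmetric functions in $L^2((\mathbb R^n)^k, d^n\mu(\mathbf p_1)\cdots d^n\mu(\mathbf p_k))$, and let $\mathscr D\subset\mathscr F^+$ be the space of finite-particle vectors whose components are symmetric Schwartz functions. On $\mathscr D$ let $$(a(\mathbf p)\Psi)_k(\mathbf p_1,\dots,\mathbf p_k)=\frac{\sqrt{k+1}}{\sqrt{2\omega_{\mathbf p}}}\,\Psi_{k+1}(\mathbf p,\mathbf p_1,\dots,\mathbf p_k),\qquad \tilde a(\mathbf x)=(2\pi)^{-n/2}\int d^n\mathbf p\,e^{-ip_kx^k}a(\mathbf p),$$ the integral being an $\mathscr F^+$-valued one. Let $a^*(\mathbf p)$, $\tilde a^*(\mathbf x)$ be the adjoints as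 sesquilinear forms on $\mathscr D$; an identity between an operator $T:\mathscr D\to\mathscr D$ and an integral of products $a^*a$ means that $\langle\Phi,T\Psi\rangle$ equals the (absolutely convergent, unless said otherwise) integral of the corresponding expression, e.g. of $\langle a(\mathbf p)\Phi,a(\mathbf q)\Psi\rangle$ for $a^*(\mathbf p)a(\mathbf q)$, for all $\Phi,\Psi\in\mathscr D$. Then $\mathbf p\mapsto a(\mathbf p)\Psi$ is integrable and differentiable and $\mathbf x\mapsto\tilde a(\mathbf x)\Psi$ is differentiable in $\mathscr F^+$ for every $\Psi\in\mathscr D$, and for all $i,j,k\in\{1,\dots,n\}$ there are unique linear operators $M_{j0}$ (boosts) and $M_{ik}$ (rotations) from $\mathscr D$ to $\mathscr D$ with $$M_{j0}=i\int d^n\mathbf p\,a^*(\mathbf p)\Big(\frac{p_j}{2\omega_{\mathbf p}}-\omega_{\mathbf p}\frac{\partial}{\partial p^j}\Big)a(\mathbf p),\qquad M_{ik}=i\int d^n\mathbf p\,a^*(\mathbf p)\Big(p_i\frac{\partial}{\partial p^k}-p_k\frac{\partial}{\partial p^i}\Big)a(\mathbf p).$$ For $\mathbf x\ne 0$ let $$\tilde\omega(\mathbf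 x)=-2(2\pi)^{-\frac{n+1}2}\Big(\frac m{|\mathbf x|}\Big)^{\frac{n+1}2}K_{\frac{n+1}2}(m|\mathbf x|),$$ where $K_\nu$ is the modified Bessel function of the second kind. Integrals containing the non-integrable kernel $\tilde\omega$ are understood as Hadamard finite parts: the integral over the region at distance more than $\varepsilon$ from the singularity (it converges absolutely) has the form $C/\varepsilon+L+o(1)$ as $\varepsilon\downarrow0$, and the value is $L$. In this sense $\tilde\omega$ is, as a tempered distribution, the Fourier transform $(2\pi)^{-n}\int d^n\mathbf p\,\omega_{\mathbf p}e^{-ip_kx^k}$ of $\omega_{\mathbf p}$, and in coordinate space $$M_{j0}=\frac12\iint d^n\mathbf x\,d^n\mathbf y\,(x+y)_j\,\tilde\omega(\mathbf x-\mathbf y)\,\tilde a^*(\mathbf x)\tilde a(\mathbf y),\qquad M_{ik}=i\int d^n\mathbf x\,\tilde a^*(\mathbf x)\Big(x_i\frac{\partial}{\partial x^k}-x_k\frac{\partial}{\partial x^i}\Big)\tilde a(\mathbf x).$$ -/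

import Mathlib

open MeasureTheory Filter Topology
open scoped SchwartzMap ENNReal NNReal InnerProductSpace

namespace ScalarField

noncomputable section

/-- Space `ℝⁿ` (of momenta as well as of positions), with the Euclidean norm.
The coordinates `x j` are the contravariant components `x^j`. -/
abbrev E (n : ℕ) : Type := EuclideanSpace ℝ (Fin n)

variable {n : ℕ}

/-- The covariant spatial component `x_j = -x^j`; the metric has signature `(+,-,…,-)`. -/
def covComp (x : E n) (j : Fin n) : ℝ := -x j

/-- The spatial contraction `p_k x^k` (summed over `k = 1, …, n`). -/
def contract (p x : E n) : ℝ := ∑ k, covComp p k * x k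

/-- The energy `ω_p = √(|p|² + m²)`. -/
def omega (m : ℝ) (p : E n) : ℝ := Real.sqrt (‖p‖ ^ 2 + m ^ 2)

/-- The partial derivative `∂F/∂x^j` of a function with values in a normed space. -/
def partialDeriv {V : Type*} [NormedAddCommGroup V] [NormedSpace ℝ V] (j : Fin n)
    (F : E n → V) (x : E n) : V :=
  fderiv ℝ F x (EuclideanSpace.single j 1)

/-! ### The Bosonic Fock space -/

/-- The Lorentz invariant measure `dⁿμ(p) = dⁿp / (2 ω_p)`. -/
def muMeas (n : ℕ) (m : ℝ) : Measure (E n) :=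
  volume.withDensity fun p => ENNReal.ofReal (1 / (2 * omega m p))

/-- The measure `dⁿμ(p₁) ⋯ dⁿμ(p_k)`. -/
def muPi (n : ℕ) (m : ℝ) (k : ℕ) : Measure (Fin k → E n) :=
  Measure.pi fun _ => muMeas n m

instance instSigmaFiniteMuMeas (m : ℝ) : SigmaFinite (muMeas n m) :=
  SigmaFinite.withDensity (μ := (volume : Measure (E n)))
    (fun p => Real.toNNReal (1 / (2 * omega m p)))

lemma measurePreserving_perm (m : ℝ) (k : ℕ) (σ : Equiv.Perm (Fin k)) :
    MeasurePreserving (fun P : Fin k → E n => P ∘ σ) (muPi n m k) (muPi n m k) := by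
  have h := measurePreserving_piCongrLeft (α := fun _ : Fin k => E n)
    (fun _ => muMeas n m) σ.symm
  have e : (fun P : Fin k → E n => P ∘ σ)
      = MeasurableEquiv.piCongrLeft (fun _ : Fin k => E n) σ.symm := by
    ext P i
    simp [MeasurableEquiv.coe_piCongrLeft, Equiv.piCongrLeft_apply]
  rw [e]
  exact h

/-- The `k`-particle space: square integrable functions of `k` momenta, with respect to
`dⁿμ(p₁) ⋯ dⁿμ(p_k)`, which are invariant under permutations of the momenta. -/
def kParticle (n : ℕ) (m : ℝ) (k : ℕ) : Submodule ℂ (Lp ℂ 2 (muPi n m k)) :=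
  ⨅ σ : Equiv.Perm (Fin k), LinearMap.eqLocus
    (Lp.compMeasurePreservingₗᵢ ℂ _ (measurePreserving_perm m k σ)).toLinearMap LinearMap.id

instance instCompleteKParticle (m : ℝ) (k : ℕ) : CompleteSpace (kParticle n m k) := by
  have : IsClosed (kParticle n m k : Set (Lp ℂ 2 (muPi n m k))) := by
    rw [kParticle, Submodule.coe_iInf]
    refine isClosed_iInter fun σ => ?_
    exact isClosed_eq
      (Lp.compMeasurePreservingₗᵢ ℂ _ (measurePreserving_perm m k σ)).continuous continuous_id
  exact this.completeSpace_coe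

/-- The Bosonic Fock space: the Hilbert space direct sum of the `k`-particle spaces. -/
def FockSpace (n : ℕ) (m : ℝ) : Type := lp (fun k : ℕ => kParticle n m k) 2

instance instNACGFock (m : ℝ) : NormedAddCommGroup (FockSpace n m) :=
  inferInstanceAs (NormedAddCommGroup (lp (fun k : ℕ => kParticle n m k) 2))

instance instIPSFock (m : ℝ) : InnerProductSpace ℂ (FockSpace n m) :=
  inferInstanceAs (InnerProductSpace ℂ (lp (fun k : ℕ => kParticle n m k) 2))

instance instCompleteFock (m : ℝ) : CompleteSpace (FockSpace n m) :=
  inferInstanceAs (CompleteSpace (lp (fun k : ℕ => kParticle n m k) 2))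

/-! ### Finite-particle states with Schwartz wave functions -/

/-- The common domain of the operators: finite-particle vectors all of whose components are
symmetric Schwartz functions of the momenta. -/
def SchwartzDomain (n : ℕ) : Submodule ℂ ((k : ℕ) → 𝓢(Fin k → E n, ℂ)) where
  carrier := {Ψ | {k | Ψ k ≠ 0}.Finite ∧
    ∀ (k : ℕ) (σ : Equiv.Perm (Fin k)) (P : Fin k → E n), Ψ k (P ∘ σ) = Ψ k P}
  add_mem' := by
    rintro Ψ Φ ⟨h1, h2⟩ ⟨h3, h4⟩
    refine ⟨(h1.union h3).subset fun k hk => ?_, fun k σ P => by simp [h2, h4]⟩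
    by_contra hc
    simp only [Set.mem_union, Set.mem_ofPred_eq, not_or, not_not] at hc
    exact hk (by simp [hc.1, hc.2])
  zero_mem' := ⟨by simp, by simp⟩
  smul_mem' := by
    rintro c Ψ ⟨h1, h2⟩
    refine ⟨h1.subset fun k hk => ?_, fun k σ P => by simp [h2]⟩
    intro hc
    exact hk (by simp [hc])

lemma muMeas_le {m : ℝ} (hm : 0 < m) :
    muMeas n m ≤ ENNReal.ofReal (1 / (2 * m)) • (volume : Measure (E n)) := by
  rw [← withDensity_const, muMeas]
  refine withDensity_mono (Eventually.of_forall fun p => ENNReal.ofReal_le_ofReal ?_)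
  have : m ≤ omega m p := Real.le_sqrt_of_sq_le (by nlinarith [sq_nonneg ‖p‖])
  gcongr

instance instTemperateMuMeas (m : ℝ) [hm : Fact (0 < m)] : (muMeas n m).HasTemperateGrowth := by
  obtain ⟨N, hN⟩ := (inferInstance : (volume : Measure (E n)).HasTemperateGrowth)
  exact ⟨N, (hN.smul_measure ENNReal.ofReal_ne_top).mono_measure (muMeas_le hm.out)⟩

instance instTemperateMuPi (m : ℝ) [hm : Fact (0 < m)] (k : ℕ) :
    (muPi n m k).HasTemperateGrowth := by
  obtain ⟨N, hN⟩ := instTemperateMuMeas (n := n) m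
  refine ⟨N * k, ?_⟩
  have h : Integrable (fun P : Fin k → E n => ∏ i, (1 + ‖P i‖) ^ (-(N : ℝ))) (muPi n m k) :=
    Integrable.fintype_prod (μ := fun _ : Fin k => muMeas n m)
      (f := fun _ p => (1 + ‖p‖) ^ (-(N : ℝ))) fun _ => hN
  refine h.mono' ?_ (Eventually.of_forall fun P => ?_)
  · refine Continuous.aestronglyMeasurable ?_
    refine Continuous.rpow_const (by fun_prop) fun P => Or.inl (by positivity)
  · rw [Real.norm_of_nonneg (by positivity)]
    have e : (1 + ‖P‖) ^ (-((N * k : ℕ) : ℝ)) = ∏ _i : Fin k, (1 + ‖P‖) ^ (-(N : ℝ)) := by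
      rw [Finset.prod_const, Finset.card_univ, Fintype.card_fin, ← Real.rpow_natCast,
        ← Real.rpow_mul (by positivity)]
      push_cast; ring_nf
    rw [e]
    refine Finset.prod_le_prod (fun _ _ => by positivity) fun i _ => ?_
    exact Real.rpow_le_rpow_of_nonpos (by positivity) (by gcongr; exact norm_le_pi_norm P i)
      (by simp)

lemma toLp_mem_kParticle {m : ℝ} [Fact (0 < m)] (Ψ : SchwartzDomain n) (k : ℕ) :
    (Ψ.1 k).toLp 2 (muPi n m k) ∈ kParticle n m k := by
  rw [kParticle, Submodule.mem_iInf]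
  intro σ
  rw [LinearMap.mem_eqLocus]
  have hσ := measurePreserving_perm (n := n) m k σ
  refine Lp.ext ?_
  have h1 : (Lp.compMeasurePreserving _ hσ ((Ψ.1 k).toLp 2 (muPi n m k)) : _ → ℂ)
      =ᵐ[muPi n m k] _ := Lp.coeFn_compMeasurePreserving _ hσ
  have h2 := (Ψ.1 k).coeFn_toLp 2 (muPi n m k)
  have h3 := hσ.quasiMeasurePreserving.ae_eq_comp h2
  refine (h1.trans h3).trans ?_
  refine EventuallyEq.trans ?_ h2.symm
  exact Eventually.of_forall fun P => Ψ.2.2 k σ P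

/-- The inclusion of the domain of Schwartz states into the Fock space. -/
def toFock (m : ℝ) [Fact (0 < m)] : SchwartzDomain n →ₗ[ℂ] FockSpace n m where
  toFun Ψ := ⟨fun k => ⟨(Ψ.1 k).toLp 2 (muPi n m k), toLp_mem_kParticle Ψ k⟩,
    (memℓp_zero (Ψ.2.1.subset fun k hk => by
      intro hc
      refine hk (Subtype.ext ?_)
      change (Ψ.1 k).toLp 2 (muPi n m k) = 0
      rw [hc]
      exact (SchwartzMap.toLpCLM ℂ ℂ 2 (muPi n m k)).map_zero)).of_exponent_ge (zero_le)⟩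
  map_add' _ _ := rfl
  map_smul' _ _ := rfl

/-! ### Ladder operators -/

lemma cons_hasTemperateGrowth (p : E n) (k : ℕ) :
    Function.HasTemperateGrowth
      (fun q : Fin k → E n => (Fin.cons p q : Fin (k + 1) → E n)) := by
  let L : (Fin k → E n) →L[ℝ] (Fin (k + 1) → E n) :=
    ContinuousLinearMap.pi fun i =>
      Fin.cases (motive := fun _ => (Fin k → E n) →L[ℝ] E n) 0
        (fun i => ContinuousLinearMap.proj i) i
  have h : (fun q : Fin k → E n => (Fin.cons p q : Fin (k + 1) → E n))
      = (fun _ => (Fin.cons p 0 : Fin (k + 1) → E n)) + (fun q => L q) := by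
    ext q i
    refine Fin.cases ?_ (fun i => ?_) i <;> simp [L]
  rw [h]
  exact (Function.HasTemperateGrowth.const _).add L.hasTemperateGrowth

lemma cons_antilipschitz (p : E n) (k : ℕ) :
    AntilipschitzWith 1
      (fun q : Fin k → E n => (Fin.cons p q : Fin (k + 1) → E n)) := by
  refine AntilipschitzWith.of_le_mul_dist fun q q' => ?_
  rw [NNReal.coe_one, one_mul]
  refine (dist_pi_le_iff dist_nonneg).2 fun i => ?_
  simpa using dist_le_pi_dist (Fin.cons p q : Fin (k + 1) → E n) (Fin.cons p q') i.succ

/-- The function `(p₁, …, p_k) ↦ ψ(p, p₁, …, p_k)`. -/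
def slice (p : E n) (k : ℕ) : 𝓢(Fin (k + 1) → E n, ℂ) →L[ℂ] 𝓢(Fin k → E n, ℂ) :=
  SchwartzMap.compCLMOfAntilipschitz ℂ (cons_hasTemperateGrowth p k) (cons_antilipschitz p k)

lemma slice_apply (p : E n) (k : ℕ) (ψ : 𝓢(Fin (k + 1) → E n, ℂ)) (q : Fin k → E n) :
    slice p k ψ q = ψ (Fin.cons p q) := rfl

/-- The covariant annihilation operator with sharp momentum,
`(a_c(p)Ψ)_k(p₁, …, p_k) = √(k+1) Ψ_{k+1}(p, p₁, …, p_k)`. -/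
def annihilationCov (p : E n) : SchwartzDomain n →ₗ[ℂ] SchwartzDomain n where
  toFun Ψ := ⟨fun k => ((Real.sqrt (k + 1) : ℝ) : ℂ) • slice p k (Ψ.1 (k + 1)), by
    refine ⟨(Ψ.2.1.preimage (f := fun k => k + 1)
      (add_left_injective 1).injOn).subset fun k hk hc => hk (by simp [hc]), fun k σ P => ?_⟩
    have h : (Fin.cons p (P ∘ σ) : Fin (k + 1) → E n)
        = (Fin.cons p P : Fin (k + 1) → E n) ∘ Equiv.Perm.decomposeFin.symm (0, σ) := by
      ext i
      refine Fin.cases ?_ (fun i => ?_) i <;> simp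
    simp [slice_apply, h, Ψ.2.2]⟩
  map_add' Ψ Φ := by
    refine Subtype.ext (funext fun k => ?_)
    simp
  map_smul' c Ψ := by
    refine Subtype.ext (funext fun k => ?_)
    simp [smul_comm c]

/-- The (noncovariant) annihilation operator `a(p) = a_c(p) / √(2 ω_p)`, applied to a Schwartz
state and regarded as a vector of the Fock space. The creation operator `a*(p)` is its adjoint as
a sesquilinear form: `⟨Φ, a*(p) Ψ⟩ = ⟨a(p) Φ, Ψ⟩`. -/
def ann (m : ℝ) [Fact (0 < m)] (p : E n) (Ψ : SchwartzDomain n) : FockSpace n m :=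
  (((Real.sqrt (2 * omega m p))⁻¹ : ℝ) : ℂ) • toFock m (annihilationCov p Ψ)

/-- The coordinate space annihilation operator
`ã(x) = (2π)^{-n/2} ∫ dⁿp e^{-i p_k x^k} a(p)`. The operator `ã*(x)` is its adjoint as a
sesquilinear form. -/
def annTilde (m : ℝ) [Fact (0 < m)] (x : E n) (Ψ : SchwartzDomain n) : FockSpace n m :=
  (((2 * Real.pi) ^ (-(n : ℝ) / 2) : ℝ) : ℂ) •
    ∫ p : E n, Complex.exp (-Complex.I * (contract p x : ℝ)) • ann m p Ψ

/-! ### The Lorentz generators in momentum space -/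

/-- The operator `T` on Schwartz states is the boost generator
`M_{j0} = i ∫ dⁿp a*(p) (p_j / (2 ω_p) - ω_p ∂/∂p^j) a(p)`. -/
def IsBoostGenerator (m : ℝ) [Fact (0 < m)] (j : Fin n)
    (T : SchwartzDomain n →ₗ[ℂ] SchwartzDomain n) : Prop :=
  ∀ Φ Ψ : SchwartzDomain n,
    Integrable (fun p : E n => ⟪ann m p Φ,
      ((covComp p j / (2 * omega m p) : ℝ) : ℂ) • ann m p Ψ
        - ((omega m p : ℝ) : ℂ) • partialDeriv j (fun q => ann m q Ψ) p⟫_ℂ) ∧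
    ⟪toFock m Φ, toFock m (T Ψ)⟫_ℂ = Complex.I * ∫ p : E n, ⟪ann m p Φ,
      ((covComp p j / (2 * omega m p) : ℝ) : ℂ) • ann m p Ψ
        - ((omega m p : ℝ) : ℂ) • partialDeriv j (fun q => ann m q Ψ) p⟫_ℂ

/-- The operator `T` on Schwartz states is the rotation generator
`M_{ik} = i ∫ dⁿp a*(p) (p_i ∂/∂p^k - p_k ∂/∂p^i) a(p)`. -/
def IsRotationGenerator (m : ℝ) [Fact (0 < m)] (i k : Fin n)
    (T : SchwartzDomain n →ₗ[ℂ] SchwartzDomain n) : Prop :=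
  ∀ Φ Ψ : SchwartzDomain n,
    Integrable (fun p : E n => ⟪ann m p Φ,
      ((covComp p i : ℝ) : ℂ) • partialDeriv k (fun q => ann m q Ψ) p
        - ((covComp p k : ℝ) : ℂ) • partialDeriv i (fun q => ann m q Ψ) p⟫_ℂ) ∧
    ⟪toFock m Φ, toFock m (T Ψ)⟫_ℂ = Complex.I * ∫ p : E n, ⟪ann m p Φ,
      ((covComp p i : ℝ) : ℂ) • partialDeriv k (fun q => ann m q Ψ) p
        - ((covComp p k : ℝ) : ℂ) • partialDeriv i (fun q => ann m q Ψ) p⟫_ℂ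

/-! ### The kernel `ω̃` -/

/-- The modified Bessel function of the second kind, `K_ν(r) = ∫₀^∞ e^{-r cosh t} cosh(ν t) dt`
for `r > 0`. -/
def besselK (ν r : ℝ) : ℝ :=
  ∫ t in Set.Ioi (0 : ℝ), Real.exp (-r * Real.cosh t) * Real.cosh (ν * t)

/-- `ω̃(x) = -2 (2π)^{-(n+1)/2} (m/|x|)^{(n+1)/2} K_{(n+1)/2}(m|x|)`, for `x ≠ 0`. -/
def omegaTilde (m : ℝ) (x : E n) : ℝ :=
  -2 * (2 * Real.pi) ^ (-((n : ℝ) + 1) / 2) * (m / ‖x‖) ^ (((n : ℝ) + 1) / 2) *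
    besselK (((n : ℝ) + 1) / 2) (m * ‖x‖)

/-- `L` is the Hadamard finite part of the divergent integral whose truncation at distance `ε`
from the singularity is `J ε`: `J ε = C / ε + L + o(1)` as `ε ↓ 0`, for some constant `C`.
Such an `L` is unique. -/
def HasFinitePart (J : ℝ → ℂ) (L : ℂ) : Prop :=
  ∃ C : ℂ, Tendsto (fun ε : ℝ => J ε - C / (ε : ℂ)) (𝓝[>] 0) (𝓝 L)

end

end ScalarField

open ScalarField

/-! Subordination, `√a = (2 √π)⁻¹ ∫ (1 - e^{-at}) t^{-3/2} dt` at `a = |p|² + m²`, writes the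
energy as a superposition of Gaussians and, off the diagonal, its Fourier transform as a negative
superposition of heat kernels, which is the Bessel integral for `ω̃`. The integral of that kernel
over `|x| > ε` diverges as `ε ↓ 0`, but like the integral of the massless kernel, which is exactly
`C / ε` by scaling; so the finite part of `∫ ω̃(x) e^{ip·x} dx` is `ω_p`, and dominated
convergence carries this over to superpositions of plane waves.

For `Ψ ∈ 𝒟` the map `p ↦ a(p)Ψ` is a Fock space valued Schwartz map, so the calculus of Schwartz
maps applies to it and to its Fourier transform `x ↦ ã(x)Ψ`. In momentum space the generators are,
up to the factor `i`, second quantizations `∑_l g(p_l) ∂/∂p_l^j`: the derivative of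
`(2 ω_p)^{-1/2}` in `a(p)` cancels the term `p_j / (2 ω_p)` of the boosts and drops out of the
rotations. In coordinate space the boost generator is the symmetrized product of `ω_p` and
`i ∂/∂p^j`, where Plancherel's identity turns `i ∂/∂p^j` into a coordinate and `ω_p` into the
integral operator with kernel `ω̃(x - y)`. -/

namespace ScalarField

open Set Real Module
open scoped Pointwise LineDeriv ContDiff FourierTransform

/-! ### Gamma and Bessel integrals -/

lemma integrableOn_rpow_mul_exp_neg_mul {s b : ℝ} (hs : 0 < s) (hb : 0 < b) :
    IntegrableOn (fun t : ℝ => t ^ (s - 1) * exp (-(b * t))) (Ioi 0) := by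
  simpa only [rpow_one, neg_mul] using
    integrableOn_rpow_mul_exp_neg_mul_rpow (s := s - 1) (by linarith) one_pos hb

lemma integral_Ioc_exp_neg_mul {a t : ℝ} (ha : 0 ≤ a) (ht : t ≠ 0) :
    ∫ u in Ioc 0 a, exp (-(u * t)) = (1 - exp (-(a * t))) / t := by
  rw [← intervalIntegral.integral_of_le ha]
  simp_rw [← mul_neg]
  rw [intervalIntegral.integral_comp_mul_right _ (neg_ne_zero.2 ht), integral_exp, zero_mul,
    exp_zero, smul_eq_mul, mul_neg]
  field_simp
  ring

/-- Integrating `u ↦ t ^ (-s) * exp (-(u * t))` over `0 < u ≤ a` first gives the integrand of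
`integral_one_sub_exp_mul_rpow`, integrating over `t > 0` first gives a Gamma integral. -/
lemma integrable_prod_rpow_mul_exp_neg_mul {s : ℝ} (hs₀ : 0 < s) (hs₁ : s < 1) (a : ℝ) :
    Integrable (fun z : ℝ × ℝ => z.2 ^ (-s) * exp (-(z.1 * z.2)))
      ((volume.restrict (Ioc 0 a)).prod (volume.restrict (Ioi 0))) := by
  have hs : 0 < 1 - s := sub_pos.2 hs₁
  have hexp : 1 - s - 1 = -s := by ring
  rw [integrable_prod_iff (by fun_prop)]
  constructor
  · filter_upwards [ae_restrict_mem measurableSet_Ioc] with u hu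
    simpa only [hexp] using (integrableOn_rpow_mul_exp_neg_mul hs hu.1).integrable
  · have hpow : IntegrableOn (fun u : ℝ => u ^ (s - 1) * Gamma (1 - s)) (Ioc 0 a) :=
      (intervalIntegral.intervalIntegrable_rpow' (by linarith)).1.mul_const _
    refine hpow.congr ?_
    filter_upwards [ae_restrict_mem measurableSet_Ioc] with u hu
    have hnorm : EqOn (fun t : ℝ => ‖t ^ (-s) * exp (-(u * t))‖)
        (fun t => t ^ (1 - s - 1) * exp (-(u * t))) (Ioi 0) := fun t ht => by
      have ht : 0 < t := ht
      beta_reduce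
      rw [hexp, norm_of_nonneg (by positivity)]
    rw [setIntegral_congr_fun measurableSet_Ioi hnorm, integral_rpow_mul_exp_neg_mul_Ioi hs hu.1,
      one_div, inv_rpow hu.1.le, ← rpow_neg hu.1.le, neg_sub]

lemma integral_Ioc_rpow_mul_exp_neg_mul {a t : ℝ} (ha : 0 ≤ a) (ht : 0 < t) (s : ℝ) :
    ∫ u in Ioc 0 a, t ^ (-s) * exp (-(u * t)) = (1 - exp (-(a * t))) * t ^ (-s - 1) := by
  rw [integral_const_mul, integral_Ioc_exp_neg_mul ha ht.ne', rpow_sub_one ht.ne']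
  ring

lemma integrableOn_one_sub_exp_mul_rpow {s a : ℝ} (hs₀ : 0 < s) (hs₁ : s < 1) (ha : 0 ≤ a) :
    IntegrableOn (fun t : ℝ => (1 - exp (-(a * t))) * t ^ (-s - 1)) (Ioi 0) := by
  refine (integrable_prod_rpow_mul_exp_neg_mul hs₀ hs₁ a).integral_prod_right.congr ?_
  filter_upwards [ae_restrict_mem measurableSet_Ioi] with t ht
  exact integral_Ioc_rpow_mul_exp_neg_mul ha ht s

lemma integral_one_sub_exp_mul_rpow {s a : ℝ} (hs₀ : 0 < s) (hs₁ : s < 1) (ha : 0 ≤ a) :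
    ∫ t in Ioi (0 : ℝ), (1 - exp (-(a * t))) * t ^ (-s - 1) = Gamma (1 - s) / s * a ^ s := by
  have hs : 0 < 1 - s := sub_pos.2 hs₁
  have inner_t : ∀ u ∈ Ioc 0 a, ∫ t in Ioi (0 : ℝ), t ^ (-s) * exp (-(u * t))
      = Gamma (1 - s) * u ^ (s - 1) := fun u hu => by
    have h := integral_rpow_mul_exp_neg_mul_Ioi hs hu.1
    rw [one_div, inv_rpow hu.1.le, ← rpow_neg hu.1.le, neg_sub, mul_comm] at h
    rw [← h]
    ring_nf
  calc ∫ t in Ioi (0 : ℝ), (1 - exp (-(a * t))) * t ^ (-s - 1)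
      = ∫ t in Ioi (0 : ℝ), ∫ u in Ioc 0 a, t ^ (-s) * exp (-(u * t)) :=
        setIntegral_congr_fun measurableSet_Ioi fun t ht =>
          (integral_Ioc_rpow_mul_exp_neg_mul ha ht s).symm
    _ = ∫ u in Ioc 0 a, ∫ t in Ioi (0 : ℝ), t ^ (-s) * exp (-(u * t)) :=
        (integral_integral_swap (integrable_prod_rpow_mul_exp_neg_mul hs₀ hs₁ a)).symm
    _ = ∫ u in (0 : ℝ)..a, Gamma (1 - s) * u ^ (s - 1) := by
        rw [setIntegral_congr_fun measurableSet_Ioc inner_t, intervalIntegral.integral_of_le ha]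
    _ = Gamma (1 - s) / s * a ^ s := by
        rw [intervalIntegral.integral_const_mul, integral_rpow (Or.inl (by linarith)),
          sub_add_cancel, zero_rpow hs₀.ne']
        ring

lemma rpow_neg_one_comp_gammaIntegrand (ν b : ℝ) {t : ℝ} (ht : 0 < t) :
    (|(-1 : ℝ)| * t ^ ((-1 : ℝ) - 1)) • ((t ^ (-1 : ℝ)) ^ (ν - 1) * exp (-(b * t ^ (-1 : ℝ))))
      = t ^ (-ν - 1) * exp (-(b / t)) := by
  rw [abs_neg, abs_one, one_mul, smul_eq_mul, ← mul_assoc, ← rpow_mul ht.le, ← rpow_add ht,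
    rpow_neg_one, div_eq_mul_inv]
  ring_nf

lemma integrableOn_rpow_mul_exp_neg_div {ν b : ℝ} (hν : 0 < ν) (hb : 0 < b) :
    IntegrableOn (fun t : ℝ => t ^ (-ν - 1) * exp (-(b / t))) (Ioi 0) :=
  ((integrableOn_Ioi_comp_rpow_iff _ (by norm_num)).2
    (integrableOn_rpow_mul_exp_neg_mul hν hb)).congr_fun
      (fun _ ht => rpow_neg_one_comp_gammaIntegrand ν b ht) measurableSet_Ioi

lemma integral_rpow_mul_exp_neg_div {ν b : ℝ} (hν : 0 < ν) (hb : 0 < b) :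
    ∫ t in Ioi (0 : ℝ), t ^ (-ν - 1) * exp (-(b / t)) = (1 / b) ^ ν * Gamma ν := by
  rw [← integral_rpow_mul_exp_neg_mul_Ioi hν hb,
    ← integral_comp_rpow_Ioi (fun s => s ^ (ν - 1) * exp (-(b * s))) (p := -1) (by norm_num)]
  exact setIntegral_congr_fun measurableSet_Ioi fun t ht =>
    (rpow_neg_one_comp_gammaIntegrand ν b ht).symm

lemma integral_Ioi_eq_integral_comp_mul_exp {F : Type*} [NormedAddCommGroup F] [NormedSpace ℝ F]
    (f : ℝ → F) {c : ℝ} (hc : 0 < c) :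
    ∫ t in Ioi (0 : ℝ), f t = ∫ s, (c * exp s) • f (c * exp s) := by
  have range_eq : (fun s => c * exp s) '' univ = Ioi 0 := by
    rw [← image_image (c * ·), image_univ, range_exp, image_mul_left_Ioi hc, mul_zero]
  have h := integral_image_eq_integral_abs_deriv_smul MeasurableSet.univ
    (fun s _ => ((hasDerivAt_exp s).const_mul c).hasDerivWithinAt)
    ((mul_right_injective₀ hc.ne').comp exp_injective).injOn f
  rw [range_eq, setIntegral_univ] at h
  simpa only [abs_of_pos (mul_pos hc (exp_pos _))] using h

lemma one_add_sq_div_two_le_cosh (x : ℝ) : 1 + x ^ 2 / 2 ≤ cosh x := by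
  have hsinh : |x| / 2 ≤ sinh (|x| / 2) := self_le_sinh_iff.2 (by positivity)
  have hcosh : cosh x = 1 + 2 * sinh (|x| / 2) ^ 2 := by
    rw [← cosh_abs, ← mul_div_cancel₀ |x| (two_ne_zero (α := ℝ)), ← mul_div_assoc,
      mul_div_assoc, cosh_two_mul, cosh_sq']
    ring_nf
  have hsq : x ^ 2 / 2 = 2 * (|x| / 2) ^ 2 := by rw [div_pow, sq_abs]; ring
  rw [hcosh, hsq]
  gcongr

lemma integrable_exp_neg_mul_cosh_mul_exp {r : ℝ} (hr : 0 < r) (ν : ℝ) :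
    Integrable fun s : ℝ => exp (-r * cosh s) * exp (-ν * s) := by
  have hgauss : Integrable fun s : ℝ => exp (-(r / 2) * s ^ 2 - ν * s) := by
    have h := (integrable_cexp_quadratic (b := ((r / 2 : ℝ) : ℂ))
      (by rw [Complex.ofReal_re]; positivity) (-ν : ℂ) 0).norm
    refine h.congr (Eventually.of_forall fun s => ?_)
    beta_reduce
    rw [Complex.norm_exp]
    norm_cast
    ring_nf
  refine hgauss.mono' (by fun_prop) (Eventually.of_forall fun s => ?_)
  rw [← exp_add, norm_of_nonneg (exp_pos _).le, exp_le_exp]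
  nlinarith [one_add_sq_div_two_le_cosh s]

lemma integral_exp_neg_mul_cosh_mul_exp {r : ℝ} (hr : 0 < r) (ν : ℝ) :
    ∫ s, exp (-r * cosh s) * exp (-ν * s) = 2 * besselK ν r := by
  have hint := integrable_exp_neg_mul_cosh_mul_exp hr ν
  have hneg : ∫ s in Iic 0, exp (-r * cosh s) * exp (-ν * s)
      = ∫ s in Ioi 0, exp (-r * cosh s) * exp (ν * s) := by
    rw [← neg_zero, ← integral_comp_neg_Ioi]
    simp only [cosh_neg, neg_mul_neg, neg_zero]
  rw [← intervalIntegral.integral_Iic_add_Ioi hint.integrableOn hint.integrableOn, hneg,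
    ← integral_add (by simpa only [neg_neg] using
      (integrable_exp_neg_mul_cosh_mul_exp hr (-ν)).restrict) hint.integrableOn,
    besselK, ← integral_const_mul]
  refine integral_congr_ae (Eventually.of_forall fun s => ?_)
  beta_reduce
  rw [cosh_eq (ν * s), neg_mul ν s]
  ring

/-- The substitution `t = c * exp s` symmetrizes the exponent. -/
lemma integral_rpow_mul_exp_neg_div_add_div {r c : ℝ} (hr : 0 < r) (hc : 0 < c) (ν : ℝ) :
    ∫ t in Ioi (0 : ℝ), t ^ (-ν - 1) * exp (-(r / 2 * (c / t + t / c)))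
      = 2 * c ^ (-ν) * besselK ν r := by
  have hsubst : ∀ s : ℝ, (c * exp s) • ((c * exp s) ^ (-ν - 1) *
      exp (-(r / 2 * (c / (c * exp s) + c * exp s / c))))
        = c ^ (-ν) * (exp (-r * cosh s) * exp (-ν * s)) := fun s => by
    have hs : 0 < c * exp s := by positivity
    have hexponent : r / 2 * (c / (c * exp s) + c * exp s / c) = r * cosh s := by
      rw [div_mul_cancel_left₀ hc.ne', mul_div_cancel_left₀ _ hc.ne', ← exp_neg, cosh_eq]
      ring
    rw [hexponent, smul_eq_mul, rpow_sub_one hs.ne', ← mul_assoc, mul_div_cancel₀ _ hs.ne',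
      mul_rpow hc.le (exp_pos s).le, ← exp_mul]
    ring_nf
  rw [integral_Ioi_eq_integral_comp_mul_exp _ hc]
  simp_rw [hsubst]
  rw [integral_const_mul, integral_exp_neg_mul_cosh_mul_exp hr ν]
  ring

/-! ### The subordinated heat kernel -/

section Subordination

variable {V : Type*} [NormedAddCommGroup V] [InnerProductSpace ℝ V]

/-- The heat kernel of `Δ` on `V` at time `t`, times the density `(2 √π)⁻¹ t ^ (-3/2)` that
represents the square root as `√a = (2 √π)⁻¹ ∫ (1 - exp (-a t)) t ^ (-3/2) dt`. -/
noncomputable def heatWeight (t : ℝ) (x : V) : ℝ :=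
  (2 * √π)⁻¹ * t ^ (-(3 / 2) : ℝ) * (4 * π * t) ^ (-(finrank ℝ V : ℝ) / 2) *
    exp (-(4 * t)⁻¹ * ‖x‖ ^ 2)

/-- The kernel of `-√(m² - Δ)` off the diagonal, as a superposition of heat kernels. At `x = 0` the
integral diverges, and the value is `0` by convention. -/
noncomputable def subordKernel (m : ℝ) (x : V) : ℝ :=
  ∫ t in Ioi (0 : ℝ), heatWeight t x * exp (-(m ^ 2 * t))

lemma heatWeight_nonneg {t : ℝ} (ht : 0 ≤ t) (x : V) : 0 ≤ heatWeight t x := by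
  unfold heatWeight
  positivity

lemma heatWeight_eq {t : ℝ} (ht : 0 < t) (x : V) :
    heatWeight t x = (2 * √π)⁻¹ * (4 * π) ^ (-(finrank ℝ V : ℝ) / 2) *
      (t ^ (-(((finrank ℝ V : ℝ) + 1) / 2) - 1) * exp (-(‖x‖ ^ 2 / 4 / t))) := by
  have hpow : t ^ (-(3 / 2) : ℝ) * t ^ (-(finrank ℝ V : ℝ) / 2)
      = t ^ (-(((finrank ℝ V : ℝ) + 1) / 2) - 1) := by
    rw [← rpow_add ht]
    ring_nf
  have hexp : -(4 * t)⁻¹ * ‖x‖ ^ 2 = -(‖x‖ ^ 2 / 4 / t) := by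
    rw [mul_inv]
    ring
  rw [heatWeight, mul_rpow (by positivity) ht.le, hexp, ← hpow]
  ring

lemma exp_neg_sq_mul_le_one (m : ℝ) {t : ℝ} (ht : 0 ≤ t) : exp (-(m ^ 2 * t)) ≤ 1 :=
  exp_le_one_iff.2 (neg_nonpos.2 (by positivity))

lemma subordKernel_nonneg (m : ℝ) (x : V) : 0 ≤ subordKernel m x :=
  setIntegral_nonneg measurableSet_Ioi fun _ ht =>
    mul_nonneg (heatWeight_nonneg (le_of_lt ht) x) (exp_pos _).le

lemma subordKernel_neg (m : ℝ) (x : V) : subordKernel m (-x) = subordKernel m x := by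
  simp only [subordKernel, heatWeight, norm_neg]

lemma integrableOn_heatWeight {x : V} (hx : x ≠ 0) :
    IntegrableOn (fun t => heatWeight t x) (Ioi 0) := by
  have hb : 0 < ‖x‖ ^ 2 / 4 := by positivity
  exact IntegrableOn.congr_fun
    ((integrableOn_rpow_mul_exp_neg_div (by positivity) hb).integrable.const_mul _)
    (fun t ht => (heatWeight_eq ht x).symm) measurableSet_Ioi

lemma integrableOn_heatWeight_mul_exp (m : ℝ) {x : V} (hx : x ≠ 0) :
    IntegrableOn (fun t => heatWeight t x * exp (-(m ^ 2 * t))) (Ioi 0) := by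
  refine (integrableOn_heatWeight hx).integrable.mul_bdd (c := 1) (by fun_prop) ?_
  filter_upwards [ae_restrict_mem measurableSet_Ioi] with t ht
  rw [norm_of_nonneg (exp_pos _).le]
  exact exp_neg_sq_mul_le_one m (le_of_lt ht)

lemma subordKernel_le_subordKernel_zero (m : ℝ) {x : V} (hx : x ≠ 0) :
    subordKernel m x ≤ subordKernel 0 x := by
  refine setIntegral_mono_on (integrableOn_heatWeight_mul_exp m hx)
    (integrableOn_heatWeight_mul_exp 0 hx) measurableSet_Ioi fun t (ht : 0 < t) => ?_
  have hexp : exp (-(m ^ 2 * t)) ≤ exp (-(0 ^ 2 * t)) := by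
    rw [zero_pow two_ne_zero, zero_mul, neg_zero, exp_zero]
    exact exp_neg_sq_mul_le_one m ht.le
  exact mul_le_mul_of_nonneg_left hexp (heatWeight_nonneg ht.le x)

variable (V) in
/-- The constant `c` with `subordKernel 0 x = c * ‖x‖ ^ (-(d + 1))`, where `d` is the dimension
of `V`. -/
noncomputable def masslessConst : ℝ :=
  (2 * √π)⁻¹ * (4 * π) ^ (-(finrank ℝ V : ℝ) / 2) *
    (4 ^ (((finrank ℝ V : ℝ) + 1) / 2) * Gamma (((finrank ℝ V : ℝ) + 1) / 2))

variable (V) in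
lemma masslessConst_nonneg : 0 ≤ masslessConst V := by
  have := Gamma_pos_of_pos (s := ((finrank ℝ V : ℝ) + 1) / 2) (by positivity)
  unfold masslessConst
  positivity

lemma subordKernel_zero {x : V} (hx : x ≠ 0) :
    subordKernel 0 x = masslessConst V * ‖x‖ ^ (-((finrank ℝ V : ℝ) + 1)) := by
  have hb : 0 < ‖x‖ ^ 2 / 4 := by positivity
  have hint : subordKernel 0 x = ∫ t in Ioi (0 : ℝ), heatWeight t x := by
    simp only [subordKernel, ne_eq, OfNat.ofNat_ne_zero, not_false_eq_true, zero_pow, zero_mul,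
      neg_zero, exp_zero, mul_one]
  have hpow : (‖x‖ ^ 2) ^ (((finrank ℝ V : ℝ) + 1) / 2) = ‖x‖ ^ ((finrank ℝ V : ℝ) + 1) := by
    rw [← rpow_natCast, ← rpow_mul (norm_nonneg x)]
    push_cast
    ring_nf
  rw [hint, setIntegral_congr_fun measurableSet_Ioi fun t ht => heatWeight_eq ht x,
    integral_const_mul, integral_rpow_mul_exp_neg_div (by positivity) hb, one_div_div,
    div_rpow zero_le_four (by positivity), hpow, rpow_neg (norm_nonneg x), masslessConst]
  ring

lemma subordKernel_zero_smul {ε : ℝ} (hε : 0 < ε) {x : V} (hx : x ≠ 0) :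
    subordKernel 0 (ε • x) = ε ^ (-((finrank ℝ V : ℝ) + 1)) * subordKernel 0 x := by
  rw [subordKernel_zero hx, subordKernel_zero (smul_ne_zero hε.ne' hx), norm_smul,
    norm_of_nonneg hε.le, mul_rpow hε.le (norm_nonneg x)]
  ring

lemma subordKernel_eq_besselK {m : ℝ} (hm : 0 < m) {x : V} (hx : x ≠ 0) :
    subordKernel m x = (2 * √π)⁻¹ * (4 * π) ^ (-(finrank ℝ V : ℝ) / 2) *
      (2 * (‖x‖ / (2 * m)) ^ (-(((finrank ℝ V : ℝ) + 1) / 2)) *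
        besselK (((finrank ℝ V : ℝ) + 1) / 2) (m * ‖x‖)) := by
  have hr : 0 < m * ‖x‖ := by positivity
  have hc : 0 < ‖x‖ / (2 * m) := by positivity
  rw [← integral_rpow_mul_exp_neg_div_add_div hr hc, ← integral_const_mul]
  refine setIntegral_congr_fun measurableSet_Ioi fun t (ht : 0 < t) => ?_
  have hexponent : -(m * ‖x‖ / 2 * (‖x‖ / (2 * m) / t + t / (‖x‖ / (2 * m))))
      = -(‖x‖ ^ 2 / 4 / t) + -(m ^ 2 * t) := by
    field_simp
    ring
  rw [heatWeight_eq ht, hexponent, exp_add]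
  ring

lemma two_mul_two_pi_rpow (d : ℝ) :
    2 * (2 * π) ^ (-(d + 1) / 2)
      = (2 * √π)⁻¹ * (4 * π) ^ (-d / 2) * (2 * 2 ^ ((d + 1) / 2)) := by
  have h4π : (4 * π) ^ (-d / 2) = 2 ^ (-d) * π ^ (-d / 2) := by
    rw [mul_rpow zero_le_four pi_pos.le, show (4 : ℝ) = 2 ^ (2 : ℝ) by norm_num,
      ← rpow_mul zero_le_two, mul_div_cancel₀ _ (two_ne_zero' ℝ)]
  have hπ : π ^ (-(d + 1) / 2) = (√π)⁻¹ * π ^ (-d / 2) := by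
    rw [sqrt_eq_rpow, ← rpow_neg pi_pos.le, ← rpow_add pi_pos]
    ring_nf
  have h2 : (2 : ℝ) ^ (-(d + 1) / 2) = 2⁻¹ * 2 ^ (-d) * 2 ^ ((d + 1) / 2) := by
    rw [← rpow_neg_one, ← rpow_add two_pos, ← rpow_add two_pos]
    ring_nf
  rw [mul_rpow zero_le_two pi_pos.le, h4π, hπ, h2, mul_inv]
  ring

lemma omegaTilde_eq_neg_subordKernel {n : ℕ} {m : ℝ} (hm : 0 < m) {x : E n} (hx : x ≠ 0) :
    omegaTilde m x = -subordKernel m x := by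
  have hpow : (‖x‖ / (2 * m)) ^ (-(((n : ℝ) + 1) / 2))
      = 2 ^ (((n : ℝ) + 1) / 2) * (m / ‖x‖) ^ (((n : ℝ) + 1) / 2) := by
    rw [rpow_neg (by positivity), ← inv_rpow (by positivity), inv_div, mul_div_assoc,
      mul_rpow zero_le_two (by positivity)]
  rw [subordKernel_eq_besselK hm hx, finrank_euclideanSpace_fin, hpow, omegaTilde]
  linear_combination -(m / ‖x‖) ^ (((n : ℝ) + 1) / 2) * besselK (((n : ℝ) + 1) / 2) (m * ‖x‖) *
    two_mul_two_pi_rpow n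

lemma cexp_neg_mul_sq_add_re (b : ℝ) (p x : V) :
    (Complex.exp (-(b : ℂ) * (‖x‖ : ℂ) ^ 2 + Complex.I * ((⟪p, x⟫_ℝ : ℝ) : ℂ))).re
      = exp (-b * ‖x‖ ^ 2) * cos ⟪p, x⟫_ℝ := by
  have hsplit : -(b : ℂ) * (‖x‖ : ℂ) ^ 2 + Complex.I * ((⟪p, x⟫_ℝ : ℝ) : ℂ)
      = ((-b * ‖x‖ ^ 2 : ℝ) : ℂ) + ((⟪p, x⟫_ℝ : ℝ) : ℂ) * Complex.I := by
    push_cast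
    ring
  rw [hsplit, Complex.exp_add, ← Complex.ofReal_exp, Complex.re_ofReal_mul,
    Complex.exp_ofReal_mul_I_re]

lemma heatWeight_mul_one_sub_nonneg (m : ℝ) {t : ℝ} (ht : 0 ≤ t) (p x : V) :
    0 ≤ heatWeight t x * (1 - exp (-(m ^ 2 * t)) * cos ⟪p, x⟫_ℝ) := by
  refine mul_nonneg (heatWeight_nonneg ht x) (sub_nonneg.2 ?_)
  exact (mul_le_of_le_one_right (exp_pos _).le (cos_le_one _)).trans (exp_neg_sq_mul_le_one m ht)

lemma integral_Ioi_heatWeight_mul_one_sub (m : ℝ) (p : V) {x : V} (hx : x ≠ 0) :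
    ∫ t in Ioi 0, heatWeight t x * (1 - exp (-(m ^ 2 * t)) * cos ⟪p, x⟫_ℝ)
      = subordKernel 0 x - subordKernel m x * cos ⟪p, x⟫_ℝ := by
  rw [subordKernel, subordKernel, ← integral_mul_const, ← integral_sub
    (integrableOn_heatWeight_mul_exp 0 hx) ((integrableOn_heatWeight_mul_exp m hx).mul_const _)]
  refine integral_congr_ae (Eventually.of_forall fun t => ?_)
  simp only [ne_eq, OfNat.ofNat_ne_zero, not_false_eq_true, zero_pow, zero_mul, neg_zero, exp_zero]
  ring

lemma subordKernel_sub_nonneg (m : ℝ) (p : V) {x : V} (hx : x ≠ 0) :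
    0 ≤ subordKernel 0 x - subordKernel m x * cos ⟪p, x⟫_ℝ :=
  sub_nonneg.2 ((mul_le_of_le_one_right (subordKernel_nonneg m x) (cos_le_one _)).trans
    (subordKernel_le_subordKernel_zero m hx))

variable [MeasurableSpace V] [BorelSpace V]

lemma measurable_heatWeight : Measurable fun z : V × ℝ => heatWeight z.2 z.1 := by
  unfold heatWeight
  fun_prop

lemma measurable_subordKernel (m : ℝ) : Measurable (subordKernel m : V → ℝ) := by
  have h : StronglyMeasurable fun z : V × ℝ => heatWeight z.2 z.1 * exp (-(m ^ 2 * z.2)) :=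
    (measurable_heatWeight.mul (by fun_prop)).stronglyMeasurable
  exact h.integral_prod_right'.measurable

end Subordination

section Truncation

variable {V F : Type*} [NormedAddCommGroup V] [MeasurableSpace V] [BorelSpace V]
  [NormedAddCommGroup F] {μ : Measure V}

lemma measurableSet_lt_norm (ε : ℝ) : MeasurableSet {x : V | ε < ‖x‖} :=
  measurableSet_lt measurable_const measurable_norm

lemma integrableOn_lt_norm_comp_neg [μ.IsNegInvariant] {f : V → F} {ε : ℝ}
    (hf : IntegrableOn f {x | ε < ‖x‖} μ) : IntegrableOn (fun x => f (-x)) {x | ε < ‖x‖} μ := by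
  simpa only [preimage_ofPred_eq, norm_neg, Function.comp_def] using
    ((Measure.measurePreserving_neg μ).integrableOn_comp_preimage
      (MeasurableEquiv.neg V).measurableEmbedding).2 hf

variable [NormedSpace ℝ F]

lemma setIntegral_lt_norm_comp_neg [μ.IsNegInvariant] (f : V → F) (ε : ℝ) :
    ∫ x in {x | ε < ‖x‖}, f (-x) ∂μ = ∫ x in {x | ε < ‖x‖}, f x ∂μ := by
  simpa only [preimage_ofPred_eq, norm_neg] using
    (Measure.measurePreserving_neg μ).setIntegral_preimage_emb
      (MeasurableEquiv.neg V).measurableEmbedding f {x | ε < ‖x‖}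

lemma tendsto_setIntegral_lt_norm [NullSingletonClass μ] {f : V → F} (hf : Integrable f μ) :
    Tendsto (fun ε : ℝ => ∫ x in {x | ε < ‖x‖}, f x ∂μ) (𝓝[>] 0) (𝓝 (∫ x, f x ∂μ)) := by
  simp_rw [← integral_indicator (measurableSet_lt_norm (V := V) _)]
  refine tendsto_integral_filter_of_dominated_convergence _
    (Eventually.of_forall fun ε => hf.aestronglyMeasurable.indicator (measurableSet_lt_norm ε))
    (Eventually.of_forall fun ε => Eventually.of_forall fun x => norm_indicator_le_norm_self _ _)
    hf.norm ?_
  filter_upwards [Measure.ae_ne μ 0] with x hx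
  refine tendsto_const_nhds.congr' ?_
  filter_upwards [Ioo_mem_nhdsGT (norm_pos_iff.2 hx)] with ε hε
  exact (indicator_of_mem (s := {x | ε < ‖x‖}) hε.2 f).symm

end Truncation

section SubordinationFourier

variable {V : Type*} [NormedAddCommGroup V] [InnerProductSpace ℝ V] [FiniteDimensional ℝ V]
  [MeasurableSpace V] [BorelSpace V]

lemma integrable_exp_neg_mul_sq_mul_cos {b : ℝ} (hb : 0 < b) (p : V) :
    Integrable fun x : V => exp (-b * ‖x‖ ^ 2) * cos ⟪p, x⟫_ℝ :=
  (GaussianFourier.integrable_cexp_neg_mul_sq_norm_add (b := b) (by rwa [Complex.ofReal_re])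
    Complex.I p).re.congr (Eventually.of_forall (cexp_neg_mul_sq_add_re b p))

lemma integral_exp_neg_mul_sq_mul_cos {b : ℝ} (hb : 0 < b) (p : V) :
    ∫ x : V, exp (-b * ‖x‖ ^ 2) * cos ⟪p, x⟫_ℝ
      = (π / b) ^ ((finrank ℝ V : ℝ) / 2) * exp (-(‖p‖ ^ 2 / (4 * b))) := by
  have hre : 0 < (b : ℂ).re := by rwa [Complex.ofReal_re]
  have hint := integral_re (GaussianFourier.integrable_cexp_neg_mul_sq_norm_add hre Complex.I p)
  rw [GaussianFourier.integral_cexp_neg_mul_sq_norm_add hre] at hint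
  rw [← integral_congr_ae (Eventually.of_forall (cexp_neg_mul_sq_add_re b p))]
  refine hint.trans ?_
  have hreal : ((π : ℂ) / (b : ℂ)) ^ ((finrank ℝ V : ℂ) / 2)
      * Complex.exp (Complex.I ^ 2 * (‖p‖ : ℂ) ^ 2 / (4 * (b : ℂ)))
      = (((π / b) ^ ((finrank ℝ V : ℝ) / 2) * exp (-(‖p‖ ^ 2 / (4 * b))) : ℝ) : ℂ) := by
    rw [Complex.ofReal_mul, Complex.ofReal_cpow (by positivity), Complex.ofReal_exp, Complex.I_sq]
    push_cast
    ring_nf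
  rw [hreal]
  exact Complex.ofReal_re _

lemma integrable_heatWeight_mul_cos {t : ℝ} (ht : 0 < t) (p : V) :
    Integrable fun x : V => heatWeight t x * cos ⟪p, x⟫_ℝ := by
  simpa only [heatWeight, mul_assoc] using
    (integrable_exp_neg_mul_sq_mul_cos (inv_pos.2 (mul_pos four_pos ht)) p).const_mul
      ((2 * √π)⁻¹ * t ^ (-(3 / 2) : ℝ) * (4 * π * t) ^ (-(finrank ℝ V : ℝ) / 2))

lemma integral_heatWeight_mul_cos {t : ℝ} (ht : 0 < t) (p : V) :
    ∫ x : V, heatWeight t x * cos ⟪p, x⟫_ℝ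
      = (2 * √π)⁻¹ * t ^ (-(3 / 2) : ℝ) * exp (-(‖p‖ ^ 2 * t)) := by
  have hcancel : (4 * π * t) ^ (-(finrank ℝ V : ℝ) / 2) * (4 * π * t) ^ ((finrank ℝ V : ℝ) / 2)
      = 1 := by
    rw [← rpow_add (by positivity), neg_div, neg_add_cancel, rpow_zero]
  have hb : π / (4 * t)⁻¹ = 4 * π * t := by rw [div_inv_eq_mul]; ring
  have he : ‖p‖ ^ 2 / (4 * (4 * t)⁻¹) = ‖p‖ ^ 2 * t := by field_simp
  simp_rw [heatWeight, mul_assoc _ (exp _)]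
  rw [integral_const_mul, integral_exp_neg_mul_sq_mul_cos (by positivity), hb, he]
  linear_combination ((2 * √π)⁻¹ * t ^ (-(3 / 2) : ℝ) * exp (-(‖p‖ ^ 2 * t))) * hcancel

lemma integrable_heatWeight_mul_one_sub (m : ℝ) {t : ℝ} (ht : 0 < t) (p : V) :
    Integrable fun x : V => heatWeight t x * (1 - exp (-(m ^ 2 * t)) * cos ⟪p, x⟫_ℝ) := by
  have h₀ := integrable_heatWeight_mul_cos ht (0 : V)
  simp only [inner_zero_left, cos_zero, mul_one] at h₀
  refine (h₀.sub ((integrable_heatWeight_mul_cos ht p).const_mul (exp (-(m ^ 2 * t))))).congr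
    (Eventually.of_forall fun x => ?_)
  simp only [Pi.sub_apply]
  ring

lemma integral_heatWeight_mul_one_sub (m : ℝ) {t : ℝ} (ht : 0 < t) (p : V) :
    ∫ x : V, heatWeight t x * (1 - exp (-(m ^ 2 * t)) * cos ⟪p, x⟫_ℝ)
      = (2 * √π)⁻¹ *
        ((1 - exp (-((‖p‖ ^ 2 + m ^ 2) * t))) * t ^ (-(1 / 2) - 1 : ℝ)) := by
  have h₀ := integrable_heatWeight_mul_cos ht (0 : V)
  have h₁ := integral_heatWeight_mul_cos ht (0 : V)
  simp only [inner_zero_left, cos_zero, mul_one, norm_zero, ne_eq, OfNat.ofNat_ne_zero,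
    not_false_eq_true, zero_pow, zero_mul, neg_zero, exp_zero] at h₀ h₁
  have hsplit : ∀ x : V, heatWeight t x * (1 - exp (-(m ^ 2 * t)) * cos ⟪p, x⟫_ℝ)
      = heatWeight t x - exp (-(m ^ 2 * t)) * (heatWeight t x * cos ⟪p, x⟫_ℝ) := fun x => by ring
  simp_rw [hsplit]
  rw [integral_sub h₀ ((integrable_heatWeight_mul_cos ht p).const_mul _), integral_const_mul, h₁,
    integral_heatWeight_mul_cos ht, show (-(1 / 2) - 1 : ℝ) = -(3 / 2) by norm_num, add_mul,
    neg_add, exp_add]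
  ring

lemma integrable_prod_heatWeight_mul_one_sub (m : ℝ) (p : V) :
    Integrable
      (fun z : V × ℝ => heatWeight z.2 z.1 * (1 - exp (-(m ^ 2 * z.2)) * cos ⟪p, z.1⟫_ℝ))
      (volume.prod (volume.restrict (Ioi 0))) := by
  rw [integrable_prod_iff' (f := fun z : V × ℝ =>
    heatWeight z.2 z.1 * (1 - exp (-(m ^ 2 * z.2)) * cos ⟪p, z.1⟫_ℝ))
    (measurable_heatWeight.mul (by fun_prop)).aestronglyMeasurable]
  constructor
  · filter_upwards [ae_restrict_mem measurableSet_Ioi] with t ht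
    exact integrable_heatWeight_mul_one_sub m ht p
  · have hsqrt := (integrableOn_one_sub_exp_mul_rpow (s := 1 / 2) (a := ‖p‖ ^ 2 + m ^ 2)
      (by norm_num) (by norm_num) (by positivity)).integrable.const_mul (2 * √π)⁻¹
    refine hsqrt.congr ?_
    filter_upwards [ae_restrict_mem measurableSet_Ioi] with t ht
    simp_rw [norm_of_nonneg (heatWeight_mul_one_sub_nonneg m (le_of_lt ht) p _)]
    exact (integral_heatWeight_mul_one_sub m ht p).symm

lemma integrable_subordKernel_sub [Nontrivial V] (m : ℝ) (p : V) :
    Integrable fun x : V => subordKernel 0 x - subordKernel m x * cos ⟪p, x⟫_ℝ := by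
  refine (integrable_prod_heatWeight_mul_one_sub m p).integral_prod_left.congr ?_
  filter_upwards [Measure.ae_ne volume 0] with x hx
  exact integral_Ioi_heatWeight_mul_one_sub m p hx

lemma integral_subordKernel_sub [Nontrivial V] (m : ℝ) (p : V) :
    ∫ x : V, (subordKernel 0 x - subordKernel m x * cos ⟪p, x⟫_ℝ) = √(‖p‖ ^ 2 + m ^ 2) := by
  have hinner : (fun x : V => subordKernel 0 x - subordKernel m x * cos ⟪p, x⟫_ℝ) =ᵐ[volume]
      fun x => ∫ t in Ioi 0, heatWeight t x * (1 - exp (-(m ^ 2 * t)) * cos ⟪p, x⟫_ℝ) := by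
    filter_upwards [Measure.ae_ne volume 0] with x hx
    exact (integral_Ioi_heatWeight_mul_one_sub m p hx).symm
  rw [integral_congr_ae hinner,
    integral_integral_swap (integrable_prod_heatWeight_mul_one_sub m p),
    setIntegral_congr_fun measurableSet_Ioi fun t ht => integral_heatWeight_mul_one_sub m ht p,
    integral_const_mul,
    integral_one_sub_exp_mul_rpow (by norm_num) (by norm_num) (by positivity),
    show (1 - 1 / 2 : ℝ) = 1 / 2 by norm_num, Gamma_one_half_eq, ← sqrt_eq_rpow]
  have : √π ≠ 0 := (sqrt_pos.2 pi_pos).ne'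
  field_simp

lemma integrableOn_subordKernel_zero {ε : ℝ} (hε : 0 < ε) :
    IntegrableOn (subordKernel 0 : V → ℝ) {x | ε < ‖x‖} := by
  have hdecay : Integrable fun x : V => (1 + ‖x‖) ^ (-((finrank ℝ V : ℝ) + 1)) :=
    integrable_one_add_norm (lt_add_one _)
  refine Integrable.mono' (((hdecay.const_mul ((1 + 1 / ε) ^ ((finrank ℝ V : ℝ) + 1))).const_mul
    (masslessConst V)).integrableOn) (measurable_subordKernel 0).aestronglyMeasurable ?_
  filter_upwards [ae_restrict_mem (measurableSet_lt_norm ε)] with x (hx : ε < ‖x‖)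
  have hx₀ : 0 < ‖x‖ := hε.trans hx
  rw [norm_of_nonneg (subordKernel_nonneg 0 x), subordKernel_zero (norm_pos_iff.1 hx₀)]
  refine mul_le_mul_of_nonneg_left ?_ (masslessConst_nonneg V)
  have hle : 1 + ‖x‖ ≤ (1 + 1 / ε) * ‖x‖ := by
    have : 1 ≤ 1 / ε * ‖x‖ := by
      rw [one_div, inv_mul_eq_div, one_le_div hε]
      exact hx.le
    linarith
  rw [rpow_neg hx₀.le, rpow_neg (by positivity), ← div_eq_mul_inv, inv_eq_one_div,
    div_le_div_iff₀ (by positivity) (by positivity), one_mul, ← mul_rpow (by positivity) hx₀.le]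
  gcongr

lemma integrableOn_subordKernel (m : ℝ) {ε : ℝ} (hε : 0 < ε) :
    IntegrableOn (subordKernel m : V → ℝ) {x | ε < ‖x‖} := by
  refine Integrable.mono' (integrableOn_subordKernel_zero hε)
    (measurable_subordKernel m).aestronglyMeasurable ?_
  filter_upwards [ae_restrict_mem (measurableSet_lt_norm ε)] with x hx
  rw [norm_of_nonneg (subordKernel_nonneg m x)]
  exact subordKernel_le_subordKernel_zero m (norm_pos_iff.1 (hε.trans hx))

lemma setIntegral_lt_norm_subordKernel_zero {ε : ℝ} (hε : 0 < ε) :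
    ∫ x in {x : V | ε < ‖x‖}, subordKernel 0 x
      = (∫ x in {x : V | 1 < ‖x‖}, subordKernel 0 x) / ε := by
  have hset : ε • {x : V | 1 < ‖x‖} = {x | ε < ‖x‖} := by
    ext x
    rw [mem_smul_set_iff_inv_smul_mem₀ hε.ne', mem_ofPred_eq, mem_ofPred_eq, norm_smul, norm_inv,
      norm_of_nonneg hε.le, inv_mul_eq_div, one_lt_div hε]
  have hscale : ∫ x in {x : V | 1 < ‖x‖}, subordKernel 0 (ε • x)
      = ε ^ (-((finrank ℝ V : ℝ) + 1)) * ∫ x in {x : V | 1 < ‖x‖}, subordKernel 0 x := by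
    rw [← integral_const_mul]
    exact setIntegral_congr_fun (measurableSet_lt_norm 1) fun x hx =>
      subordKernel_zero_smul hε (norm_pos_iff.1 (one_pos.trans hx))
  have hsubst := Measure.setIntegral_comp_smul_of_pos (volume : Measure V) (subordKernel 0)
    {x : V | 1 < ‖x‖} hε
  rw [hset, hscale, smul_eq_mul, rpow_neg hε.le, rpow_add_one hε.ne', rpow_natCast] at hsubst
  have : ε ^ finrank ℝ V ≠ 0 := by positivity
  field_simp at hsubst ⊢
  linarith

end SubordinationFourier

section FinitePart

variable {V : Type*} [NormedAddCommGroup V] [InnerProductSpace ℝ V] [FiniteDimensional ℝ V]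
  [MeasurableSpace V] [BorelSpace V] {h : V → ℂ}

/-- The superposition `x ↦ ∫ exp(i ⟪p, x⟫) h(p) dp` of plane waves. There is no factor `2 π`, in the
exponent or in front. -/
noncomputable def planeWaveIntegral (h : V → ℂ) (x : V) : ℂ :=
  ∫ p, Complex.exp (⟪p, x⟫_ℝ * Complex.I) * h p

lemma integrable_planeWave_mul (hh : Integrable h) (x : V) :
    Integrable fun p => Complex.exp (⟪p, x⟫_ℝ * Complex.I) * h p :=
  hh.bdd_mul (c := 1) (Continuous.aestronglyMeasurable (by fun_prop))
    (Eventually.of_forall fun p => (Complex.norm_exp_ofReal_mul_I _).le)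

lemma continuous_planeWaveIntegral (hh : Integrable h) : Continuous (planeWaveIntegral h) :=
  continuous_of_dominated (fun x => (integrable_planeWave_mul hh x).aestronglyMeasurable)
    (fun x => Eventually.of_forall fun p => by
      rw [norm_mul, Complex.norm_exp_ofReal_mul_I, one_mul])
    hh.norm (Eventually.of_forall fun p => by fun_prop)

lemma norm_planeWaveIntegral_le (h : V → ℂ) (x : V) : ‖planeWaveIntegral h x‖ ≤ ∫ p, ‖h p‖ := by
  refine (norm_integral_le_integral_norm _).trans_eq (integral_congr_ae ?_)
  exact Eventually.of_forall fun p => by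
    simp only [norm_mul, Complex.norm_exp_ofReal_mul_I, one_mul]

lemma integral_cos_mul (hh : Integrable h) (x : V) :
    ∫ p, (cos ⟪p, x⟫_ℝ : ℂ) * h p = (planeWaveIntegral h x + planeWaveIntegral h (-x)) / 2 := by
  rw [planeWaveIntegral, planeWaveIntegral, ← integral_add (integrable_planeWave_mul hh x)
    (integrable_planeWave_mul hh (-x)), ← integral_div]
  refine integral_congr_ae (Eventually.of_forall fun p => ?_)
  simp only [inner_neg_right, Complex.ofReal_neg, Complex.ofReal_cos, Complex.cos]
  ring

lemma integrable_cos_mul (hh : Integrable h) (x : V) :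
    Integrable fun p => (cos ⟪p, x⟫_ℝ : ℂ) * h p :=
  hh.bdd_mul (c := 1) (Continuous.aestronglyMeasurable (by fun_prop))
    (Eventually.of_forall fun p => by
      rw [Complex.norm_real]
      exact abs_cos_le_one _)

lemma integrableOn_subordKernel_mul_planeWaveIntegral (m : ℝ) (hh : Integrable h) {ε : ℝ}
    (hε : 0 < ε) :
    IntegrableOn (fun x => (subordKernel m x : ℂ) * planeWaveIntegral h x) {x | ε < ‖x‖} :=
  (integrableOn_subordKernel m hε).integrable.ofReal.mul_bdd
    (continuous_planeWaveIntegral hh).aestronglyMeasurable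
    (Eventually.of_forall (norm_planeWaveIntegral_le h))

/-- Since `subordKernel m` is even, only the even part of its cofactor matters. -/
lemma setIntegral_subordKernel_mul_planeWaveIntegral (m : ℝ) (hh : Integrable h) {ε : ℝ}
    (hε : 0 < ε) :
    ∫ x in {x : V | ε < ‖x‖}, (subordKernel m x : ℂ) * planeWaveIntegral h x
      = ∫ x in {x : V | ε < ‖x‖}, (subordKernel m x : ℂ) * ∫ p, (cos ⟪p, x⟫_ℝ : ℂ) * h p := by
  have hint := integrableOn_subordKernel_mul_planeWaveIntegral m hh hε
  have hneg := setIntegral_lt_norm_comp_neg (μ := volume)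
    (fun x => (subordKernel m x : ℂ) * planeWaveIntegral h x) ε
  have hint_neg := integrableOn_lt_norm_comp_neg hint
  simp_rw [subordKernel_neg] at hneg hint_neg
  have hsplit : ∀ x : V, (subordKernel m x : ℂ) * ∫ p, (cos ⟪p, x⟫_ℝ : ℂ) * h p
      = ((subordKernel m x : ℂ) * planeWaveIntegral h x
        + (subordKernel m x : ℂ) * planeWaveIntegral h (-x)) / 2 := fun x => by
    rw [integral_cos_mul hh]
    ring
  simp_rw [hsplit]
  rw [integral_div, integral_add hint hint_neg, hneg, add_self_div_two]

lemma integral_subordKernel_sub_mul (m : ℝ) (hh : Integrable h) (x : V) :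
    ∫ p, ((subordKernel 0 x - subordKernel m x * cos ⟪p, x⟫_ℝ : ℝ) : ℂ) * h p
      = (subordKernel 0 x : ℂ) * (∫ p, h p)
        - (subordKernel m x : ℂ) * ∫ p, (cos ⟪p, x⟫_ℝ : ℂ) * h p := by
  rw [← integral_const_mul, ← integral_const_mul, ← integral_sub (hh.const_mul _)
    ((integrable_cos_mul hh x).const_mul _)]
  refine integral_congr_ae (Eventually.of_forall fun p => ?_)
  push_cast
  ring

variable [Nontrivial V]

lemma integrable_prod_subordKernel_sub_mul (m : ℝ) (hh : AEStronglyMeasurable h)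
    (hω : Integrable fun p => (√(‖p‖ ^ 2 + m ^ 2) : ℂ) * h p) :
    Integrable
      (fun z : V × V =>
        ((subordKernel 0 z.1 - subordKernel m z.1 * cos ⟪z.2, z.1⟫_ℝ : ℝ) : ℂ) * h z.2)
      (volume.prod volume) := by
  have hmeas : Measurable fun z : V × V =>
      subordKernel 0 z.1 - subordKernel m z.1 * cos ⟪z.2, z.1⟫_ℝ :=
    ((measurable_subordKernel 0).comp measurable_fst).sub
      (((measurable_subordKernel m).comp measurable_fst).mul (by fun_prop))
  have hmeas_mul : AEStronglyMeasurable
      (fun z : V × V =>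
        ((subordKernel 0 z.1 - subordKernel m z.1 * cos ⟪z.2, z.1⟫_ℝ : ℝ) : ℂ) * h z.2)
      (volume.prod volume) :=
    (Complex.measurable_ofReal.comp hmeas).aestronglyMeasurable.mul hh.comp_snd
  rw [integrable_prod_iff' hmeas_mul]
  refine ⟨Eventually.of_forall fun p => (integrable_subordKernel_sub m p).ofReal.mul_const (h p),
    hω.norm.congr (Eventually.of_forall fun p => ?_)⟩
  have hnorm : ∀ᵐ x : V, ‖((subordKernel 0 x - subordKernel m x * cos ⟪p, x⟫_ℝ : ℝ) : ℂ) * h p‖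
      = (subordKernel 0 x - subordKernel m x * cos ⟪p, x⟫_ℝ) * ‖h p‖ := by
    filter_upwards [Measure.ae_ne volume 0] with x hx
    rw [norm_mul, Complex.norm_real, norm_of_nonneg (subordKernel_sub_nonneg m p hx)]
  beta_reduce
  rw [integral_congr_ae hnorm, integral_mul_const, integral_subordKernel_sub, norm_mul,
    Complex.norm_real, norm_of_nonneg (sqrt_nonneg _)]

/-- The constant subtracted is the integral of the massless kernel, which scales as `1 / ε`. -/
theorem tendsto_div_sub_setIntegral_subordKernel (m : ℝ) (hh : Integrable h)
    (hω : Integrable fun p => (√(‖p‖ ^ 2 + m ^ 2) : ℂ) * h p) :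
    Tendsto (fun ε : ℝ =>
      ((∫ x in {x : V | 1 < ‖x‖}, subordKernel 0 x : ℝ) : ℂ) * (∫ p, h p) / ε
        - ∫ x in {x : V | ε < ‖x‖}, (subordKernel m x : ℂ) * planeWaveIntegral h x)
      (𝓝[>] 0) (𝓝 (∫ p, (√(‖p‖ ^ 2 + m ^ 2) : ℂ) * h p)) := by
  have hprod := integrable_prod_subordKernel_sub_mul m hh.aestronglyMeasurable hω
  have hint := hprod.integral_prod_left
  have hswap := integral_integral_swap (f := fun x p : V =>
    ((subordKernel 0 x - subordKernel m x * cos ⟪p, x⟫_ℝ : ℝ) : ℂ) * h p) hprod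
  simp_rw [integral_mul_const, integral_complex_ofReal, integral_subordKernel_sub] at hswap
  rw [← hswap]
  refine (tendsto_setIntegral_lt_norm hint).congr' ?_
  filter_upwards [self_mem_nhdsWithin] with ε (hε : 0 < ε)
  simp_rw [integral_subordKernel_sub_mul m hh]
  have hzero : IntegrableOn (fun x => (subordKernel 0 x : ℂ) * ∫ p, h p) {x : V | ε < ‖x‖} :=
    (integrableOn_subordKernel_zero hε).integrable.ofReal.mul_const _
  have hcos : IntegrableOn (fun x => (subordKernel m x : ℂ) * ∫ p, (cos ⟪p, x⟫_ℝ : ℂ) * h p)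
      {x : V | ε < ‖x‖} := by
    refine (hzero.integrable.sub hint.integrableOn).congr (Eventually.of_forall fun x => ?_)
    simp only [Pi.sub_apply, integral_subordKernel_sub_mul m hh, sub_sub_cancel]
  rw [integral_sub hzero hcos,
    ← setIntegral_subordKernel_mul_planeWaveIntegral m hh hε, integral_mul_const,
    integral_complex_ofReal, setIntegral_lt_norm_subordKernel_zero hε]
  push_cast
  ring

end FinitePart

section OmegaTilde

variable {n : ℕ} {m : ℝ} {h : E n → ℂ}

lemma eqOn_omegaTilde_mul_planeWaveIntegral (hm : 0 < m) (h : E n → ℂ) {ε : ℝ} (hε : 0 ≤ ε) :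
    EqOn (fun x : E n => (omegaTilde m x : ℂ) * planeWaveIntegral h x)
      (fun x => -((subordKernel m x : ℂ) * planeWaveIntegral h x)) {x | ε < ‖x‖} := fun x hx => by
  beta_reduce
  rw [omegaTilde_eq_neg_subordKernel hm (norm_pos_iff.1 (hε.trans_lt hx)), Complex.ofReal_neg,
    neg_mul]

lemma integrableOn_omegaTilde_mul_planeWaveIntegral (hm : 0 < m) (hh : Integrable h) {ε : ℝ}
    (hε : 0 < ε) :
    IntegrableOn (fun x : E n => (omegaTilde m x : ℂ) * planeWaveIntegral h x) {x | ε < ‖x‖} :=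
  IntegrableOn.congr_fun (integrableOn_subordKernel_mul_planeWaveIntegral m hh hε).integrable.neg
    (eqOn_omegaTilde_mul_planeWaveIntegral hm h hε.le).symm (measurableSet_lt_norm ε)

theorem hasFinitePart_omegaTilde_mul_planeWaveIntegral [Nontrivial (E n)] (hm : 0 < m)
    (hh : Integrable h) (hω : Integrable fun p => (omega m p : ℂ) * h p) :
    HasFinitePart
      (fun ε => ∫ x in {x : E n | ε < ‖x‖}, (omegaTilde m x : ℂ) * planeWaveIntegral h x)
      (∫ p, (omega m p : ℂ) * h p) := by
  refine ⟨-(((∫ x in {x : E n | 1 < ‖x‖}, subordKernel 0 x : ℝ) : ℂ) * ∫ p, h p),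
    (tendsto_div_sub_setIntegral_subordKernel m hh hω).congr' ?_⟩
  filter_upwards [self_mem_nhdsWithin] with ε (hε : 0 < ε)
  rw [setIntegral_congr_fun (measurableSet_lt_norm ε)
    (eqOn_omegaTilde_mul_planeWaveIntegral hm h hε.le), integral_neg]
  ring

end OmegaTilde

/-! ### Schwartz maps with values in a normed space -/

section Taylor

variable {X V : Type*} [NormedAddCommGroup X] [NormedSpace ℝ X]
  [NormedAddCommGroup V] [NormedSpace ℝ V]

lemma norm_sub_sub_le_of_norm_snd_fderiv_le {f : X → V} {f' : X → X →L[ℝ] V}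
    {f'' : X → X →L[ℝ] X →L[ℝ] V} {x y : X} {C : ℝ}
    (hf : ∀ z ∈ segment ℝ x y, HasFDerivAt f (f' z) z)
    (hf' : ∀ z ∈ segment ℝ x y, HasFDerivAt f' (f'' z) z)
    (hC : ∀ z ∈ segment ℝ x y, ‖f'' z‖ ≤ C) :
    ‖f y - f x - f' x (y - x)‖ ≤ C * ‖y - x‖ ^ 2 := by
  have hx := left_mem_segment ℝ x y
  have hy := right_mem_segment ℝ x y
  have hC0 : 0 ≤ C := (f'' x).opNorm_nonneg.trans (hC x hx)
  have hlip : ∀ z ∈ segment ℝ x y, ‖f' z - f' x‖ ≤ C * ‖y - x‖ := fun z hz =>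
    ((convex_segment x y).norm_image_sub_le_of_norm_hasFDerivWithin_le
      (fun w hw => (hf' w hw).hasFDerivWithinAt) hC hx hz).trans
      (mul_le_mul_of_nonneg_left (norm_sub_le_of_mem_segment hz) hC0)
  calc ‖f y - f x - f' x (y - x)‖ ≤ C * ‖y - x‖ * ‖y - x‖ :=
        (convex_segment x y).norm_image_sub_le_of_norm_hasFDerivWithin_le'
          (fun w hw => (hf w hw).hasFDerivWithinAt) hlip hx hy
    _ = C * ‖y - x‖ ^ 2 := by ring

lemma exists_pow_mul_norm_sub_sub_fderiv_le (f : 𝓢(X, V)) (i : ℕ) :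
    ∃ C : ℝ, 0 ≤ C ∧ ∀ (x y : X) (r : ℝ), 0 ≤ r → (∀ z ∈ segment ℝ x y, r ≤ ‖z‖) →
      r ^ i * ‖f y - f x - fderiv ℝ f x (y - x)‖ ≤ C * ‖y - x‖ ^ 2 := by
  set f' : 𝓢(X, X →L[ℝ] V) := SchwartzMap.fderivCLM ℝ X V f
  set f'' : 𝓢(X, X →L[ℝ] X →L[ℝ] V) := SchwartzMap.fderivCLM ℝ X (X →L[ℝ] V) f'
  obtain ⟨C, hC0, hC⟩ := f''.decay i 0
  refine ⟨C, hC0.le, fun x y r hr hz => ?_⟩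
  have hri : 0 ≤ r ^ i := by positivity
  have hbound : ∀ z ∈ segment ℝ x y, ‖r ^ i • f'' z‖ ≤ C := fun z hzs => by
    have h := hC z
    rw [norm_iteratedFDeriv_zero] at h
    calc ‖r ^ i • f'' z‖ ≤ ‖r ^ i‖ * ‖f'' z‖ := (f'' z).opNorm_smul_le _
      _ = r ^ i * ‖f'' z‖ := by rw [Real.norm_of_nonneg hri]
      _ ≤ ‖z‖ ^ i * ‖f'' z‖ :=
        mul_le_mul_of_nonneg_right (pow_le_pow_left₀ hr (hz z hzs) i) (f'' z).opNorm_nonneg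
      _ ≤ C := h
  have h := norm_sub_sub_le_of_norm_snd_fderiv_le (f := fun z => r ^ i • f z)
    (f' := fun z => r ^ i • f' z) (fun z _ => (f.hasFDerivAt z).const_smul _)
    (fun z _ => (f'.hasFDerivAt z).const_smul (r ^ i)) hbound
  rwa [smul_apply, ← smul_sub, ← smul_sub, norm_smul, Real.norm_of_nonneg hri] at h

end Taylor

section Family

variable {n : ℕ} {V : Type*} [NormedAddCommGroup V] [NormedSpace ℝ V]

/-- The linear map with the partial derivatives `v`, that is `h ↦ ∑ j, h j • v j`. -/
noncomputable def gradCLM (v : Fin n → V) : E n →L[ℝ] V :=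
  ∑ j, ContinuousLinearMap.smulRightL ℝ (E n) V (EuclideanSpace.proj j) (v j)

lemma gradCLM_apply (v : Fin n → V) (h : E n) : gradCLM v h = ∑ j, h j • v j := by
  simp [gradCLM]

lemma gradCLM_single (v : Fin n → V) (j : Fin n) :
    gradCLM v (EuclideanSpace.single j 1) = v j := by
  simp [gradCLM_apply, ite_smul]

variable {ι : Type*} {F : ι → E n → V} {D : Fin n → ι → ι}

lemma contDiff_of_closed_family
    (hF : ∀ i p, HasFDerivAt (F i) (gradCLM fun j => F (D j i) p) p) (r : ℕ) (i : ι) :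
    ContDiff ℝ r (F i) := by
  induction r generalizing i with
  | zero => exact contDiff_zero.2 (continuous_iff_continuousAt.2 fun p => (hF i p).continuousAt)
  | succ r ih =>
    have hfderiv : fderiv ℝ (F i) = fun p => gradCLM fun j => F (D j i) p :=
      funext fun p => (hF i p).fderiv
    rw [Nat.cast_succ]
    refine contDiff_succ_iff_fderiv.2 ⟨fun p => (hF i p).differentiableAt, by simp, ?_⟩
    rw [hfderiv]
    exact ContDiff.sum fun j _ => (ContinuousLinearMap.contDiff _).comp (ih (D j i))

lemma decay_of_closed_family
    (hF : ∀ i p, HasFDerivAt (F i) (gradCLM fun j => F (D j i) p) p)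
    (hdec : ∀ i N, ∃ C : ℝ, ∀ p, ‖p‖ ^ N * ‖F i p‖ ≤ C) (N r : ℕ) (i : ι) :
    ∃ C : ℝ, ∀ p, ‖p‖ ^ N * ‖iteratedFDeriv ℝ r (F i) p‖ ≤ C := by
  induction r generalizing i with
  | zero => simpa only [norm_iteratedFDeriv_zero] using hdec i N
  | succ r ih =>
    choose C hC using ih
    set L : Fin n → V →L[ℝ] (E n →L[ℝ] V) := fun j =>
      ContinuousLinearMap.smulRightL ℝ (E n) V (EuclideanSpace.proj j)
    refine ⟨∑ j, ‖L j‖ * C (D j i), fun p => ?_⟩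
    have hfderiv : fderiv ℝ (F i) = fun p => ∑ j, (L j ∘ F (D j i)) p :=
      funext fun p => (hF i p).fderiv
    rw [← norm_iteratedFDeriv_fderiv, hfderiv, iteratedFDeriv_fun_sum_apply fun j _ =>
      ((L j).contDiff.comp (contDiff_of_closed_family hF r (D j i))).contDiffAt]
    calc ‖p‖ ^ N * ‖∑ j, iteratedFDeriv ℝ r (L j ∘ F (D j i)) p‖
        ≤ ‖p‖ ^ N * ∑ j, ‖iteratedFDeriv ℝ r (L j ∘ F (D j i)) p‖ := by
          gcongr; exact norm_sum_le _ _
      _ ≤ ‖p‖ ^ N * ∑ j, ‖L j‖ * ‖iteratedFDeriv ℝ r (F (D j i)) p‖ := by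
          gcongr with j
          exact (L j).norm_iteratedFDeriv_comp_left
            (contDiff_of_closed_family hF r (D j i)).contDiffAt le_rfl
      _ = ∑ j, ‖L j‖ * (‖p‖ ^ N * ‖iteratedFDeriv ℝ r (F (D j i)) p‖) := by
          rw [Finset.mul_sum]; congr 1; ext j; ring
      _ ≤ ∑ j, ‖L j‖ * C (D j i) := by gcongr with j; exact hC _ _

/-- A member of a family of rapidly decreasing functions which is closed under partial
derivatives (the `j`-th one being `D j` on indices), as a Schwartz map. -/
noncomputable def schwartzOfFamily
    (hF : ∀ i p, HasFDerivAt (F i) (gradCLM fun j => F (D j i) p) p)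
    (hdec : ∀ i N, ∃ C : ℝ, ∀ p, ‖p‖ ^ N * ‖F i p‖ ≤ C) (i : ι) : 𝓢(E n, V) where
  toFun := F i
  smooth' := contDiff_infty.2 fun r => contDiff_of_closed_family hF r i
  decay' N r := decay_of_closed_family hF hdec N r i

end Family

/-! ### Slices of Schwartz functions as `L²`-valued Schwartz maps -/

section Slices

variable {n k : ℕ}

/-- The displacement of the `l`-th momentum by the `j`-th unit vector. -/
noncomputable def axis (l : Fin k) (j : Fin n) : Fin k → E n :=
  Pi.single l (EuclideanSpace.single j 1)

/-- The partial derivative in the `j`-th component of the `l`-th momentum. -/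
noncomputable def axisDeriv (l : Fin k) (j : Fin n) :
    𝓢(Fin k → E n, ℂ) →L[ℂ] 𝓢(Fin k → E n, ℂ) :=
  LineDeriv.lineDerivOpCLM ℂ _ (axis l j)

lemma axisDeriv_apply (l : Fin k) (j : Fin n) (ψ : 𝓢(Fin k → E n, ℂ)) (P : Fin k → E n) :
    axisDeriv l j ψ P = fderiv ℝ ψ P (axis l j) := rfl

lemma sum_smul_axis (l : Fin k) (h : E n) : ∑ j, h j • axis l j = Pi.single l h := by
  ext i j
  rw [Finset.sum_apply]
  obtain rfl | hi := eq_or_ne i l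
  · simp [axis, Pi.single_apply]
  · simp [axis, hi]

lemma fderiv_single_eq (l : Fin k) (ψ : 𝓢(Fin k → E n, ℂ)) (P : Fin k → E n) (h : E n) :
    fderiv ℝ ψ P (Pi.single l h) = ∑ j, h j • axisDeriv l j ψ P := by
  simp [← sum_smul_axis, axisDeriv_apply]

lemma norm_tail_le_norm_cons (q : E n) (P : Fin k → E n) :
    ‖P‖ ≤ ‖(Fin.cons q P : Fin (k + 1) → E n)‖ :=
  (pi_norm_le_iff_of_nonneg (norm_nonneg _)).2 fun i => by
    simpa using norm_le_pi_norm (Fin.cons q P : Fin (k + 1) → E n) i.succ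

lemma norm_head_le_norm_cons (q : E n) (P : Fin k → E n) :
    ‖q‖ ≤ ‖(Fin.cons q P : Fin (k + 1) → E n)‖ := by
  simpa using norm_le_pi_norm (Fin.cons q P : Fin (k + 1) → E n) 0

lemma norm_tail_le_of_mem_segment_cons (p q : E n) (P : Fin k → E n) {Z : Fin (k + 1) → E n}
    (hZ : Z ∈ segment ℝ (Fin.cons p P : Fin (k + 1) → E n) (Fin.cons q P)) : ‖P‖ ≤ ‖Z‖ := by
  obtain ⟨a, b, -, -, hab, rfl⟩ := hZ
  refine (norm_tail_le_norm_cons (a • p + b • q) P).trans_eq (congrArg norm ?_)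
  ext i
  refine Fin.cases ?_ (fun i => ?_) i
  · simp
  · simp [← add_mul, hab]

lemma cons_add_sub_cons (p h : E n) (P : Fin k → E n) :
    (Fin.cons (p + h) P : Fin (k + 1) → E n) - Fin.cons p P = Pi.single 0 h := by
  ext i
  refine Fin.cases ?_ (fun i => ?_) i <;> simp

lemma slice_taylor (ψ : 𝓢(Fin (k + 1) → E n, ℂ)) (i : ℕ) :
    ∃ C : ℝ, 0 ≤ C ∧ ∀ (p h : E n) (P : Fin k → E n),
      ‖P‖ ^ i * ‖ψ (Fin.cons (p + h) P) - ψ (Fin.cons p P)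
        - ∑ j, h j • axisDeriv 0 j ψ (Fin.cons p P)‖ ≤ C * ‖h‖ ^ 2 := by
  obtain ⟨C, hC0, hC⟩ := exists_pow_mul_norm_sub_sub_fderiv_le ψ i
  refine ⟨C, hC0, fun p h P => ?_⟩
  have key := hC (Fin.cons p P) (Fin.cons (p + h) P) ‖P‖ (norm_nonneg P)
    fun Z hZ => norm_tail_le_of_mem_segment_cons p (p + h) P hZ
  rwa [cons_add_sub_cons, fderiv_single_eq, Pi.norm_single] at key

end Slices

section SliceLp

variable {n : ℕ} (m : ℝ) [Fact (0 < m)]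

lemma exists_norm_toLp_le (n k : ℕ) : ∃ (M : ℕ) (K : ℝ),
    ∀ (f : 𝓢(Fin k → E n, ℂ)) (B : ℝ), 0 ≤ B → (∀ i ≤ M, ∀ P, ‖P‖ ^ i * ‖f P‖ ≤ B) →
      ‖f.toLp 2 (muPi n m k)‖ ≤ K * B := by
  obtain ⟨M, K, hK, h⟩ := SchwartzMap.norm_toLp_le_seminorm ℝ (E := Fin k → E n) ℂ 2 (muPi n m k)
  refine ⟨M, K, fun f B hB hf => (h f).trans (mul_le_mul_of_nonneg_left ?_ hK)⟩
  refine Seminorm.finset_sup_apply_le hB fun i hi => ?_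
  obtain ⟨hi1, hi2⟩ := Prod.le_def.1 (Finset.mem_Iic.1 hi)
  rw [SchwartzMap.schwartzSeminormFamily_apply, Nat.le_zero.1 hi2]
  exact SchwartzMap.seminorm_le_bound ℝ _ _ f hB fun P => by
    rw [norm_iteratedFDeriv_zero]; exact hf _ hi1 P

/-- The slice `ψ(p, ·)` as a vector of `L²`. -/
noncomputable def sliceLp (k : ℕ) (ψ : 𝓢(Fin (k + 1) → E n, ℂ)) (p : E n) :
    Lp ℂ 2 (muPi n m k) :=
  (slice p k ψ).toLp 2 (muPi n m k)

lemma sliceLp_add_sub_sub_gradCLM (k : ℕ) (ψ : 𝓢(Fin (k + 1) → E n, ℂ)) (p h : E n) :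
    sliceLp m k ψ (p + h) - sliceLp m k ψ p
        - gradCLM (fun j => sliceLp m k (axisDeriv 0 j ψ) p) h
      = (slice (p + h) k ψ - slice p k ψ - ∑ j, h j • slice p k (axisDeriv 0 j ψ)).toLp 2
        (muPi n m k) := by
  change _ = SchwartzMap.toLpCLM ℝ ℂ 2 (muPi n m k) _
  rw [map_sub, map_sub, map_sum, gradCLM_apply]
  simp only [map_smul]
  rfl

lemma hasFDerivAt_sliceLp (k : ℕ) (ψ : 𝓢(Fin (k + 1) → E n, ℂ)) (p : E n) :
    HasFDerivAt (sliceLp m k ψ) (gradCLM fun j => sliceLp m k (axisDeriv 0 j ψ) p) p := by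
  obtain ⟨M, K, hM⟩ := exists_norm_toLp_le m n k
  choose C hC0 hC using slice_taylor ψ
  have hO : (fun h : E n => sliceLp m k ψ (p + h) - sliceLp m k ψ p
      - gradCLM (fun j => sliceLp m k (axisDeriv 0 j ψ) p) h) =O[𝓝 0] fun h => ‖h‖ ^ 2 := by
    refine Asymptotics.IsBigO.of_bound (K * ∑ i ∈ Finset.range (M + 1), C i)
      (Eventually.of_forall fun h => ?_)
    rw [sliceLp_add_sub_sub_gradCLM, norm_pow, norm_norm, mul_assoc]
    refine hM _ _ (mul_nonneg (Finset.sum_nonneg fun i _ => hC0 i) (by positivity)) fun i hi P => ?_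
    have hCi : C i ≤ ∑ i ∈ Finset.range (M + 1), C i :=
      Finset.single_le_sum (fun i _ => hC0 i) (Finset.mem_range.2 (Nat.lt_succ_of_le hi))
    calc ‖P‖ ^ i * ‖(slice (p + h) k ψ - slice p k ψ
            - ∑ j, h j • slice p k (axisDeriv 0 j ψ)) P‖
        = ‖P‖ ^ i * ‖ψ (Fin.cons (p + h) P) - ψ (Fin.cons p P)
            - ∑ j, h j • axisDeriv 0 j ψ (Fin.cons p P)‖ := by simp [slice_apply]
      _ ≤ C i * ‖h‖ ^ 2 := hC i p h P
      _ ≤ (∑ i ∈ Finset.range (M + 1), C i) * ‖h‖ ^ 2 := by gcongr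
  rw [hasFDerivAt_iff_isLittleO_nhds_zero]
  exact hO.trans_isLittleO (Asymptotics.isLittleO_norm_pow_id one_lt_two)

lemma sliceLp_decay (k : ℕ) (ψ : 𝓢(Fin (k + 1) → E n, ℂ)) (N : ℕ) :
    ∃ C : ℝ, ∀ p, ‖p‖ ^ N * ‖sliceLp m k ψ p‖ ≤ C := by
  obtain ⟨M, K, hM⟩ := exists_norm_toLp_le m n k
  choose C hC0 hC using fun i => ψ.decay (N + i) 0
  refine ⟨K * ∑ i ∈ Finset.range (M + 1), C i, fun p => ?_⟩
  have hsmul : ((‖p‖ ^ N) • slice p k ψ).toLp 2 (muPi n m k) = (‖p‖ ^ N) • sliceLp m k ψ p :=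
    (SchwartzMap.toLpCLM ℝ ℂ 2 (muPi n m k)).map_smul _ _
  have hnorm : ‖p‖ ^ N * ‖sliceLp m k ψ p‖ = ‖((‖p‖ ^ N) • slice p k ψ).toLp 2 (muPi n m k)‖ := by
    rw [hsmul, norm_smul, norm_pow, norm_norm]
  rw [hnorm]
  refine hM _ _ (Finset.sum_nonneg fun i _ => (hC0 i).le) fun i hi P => ?_
  calc ‖P‖ ^ i * ‖((‖p‖ ^ N) • slice p k ψ) P‖
      = ‖p‖ ^ N * ‖P‖ ^ i * ‖ψ (Fin.cons p P)‖ := by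
        rw [smul_apply, norm_smul, norm_pow, norm_norm, slice_apply]; ring
    _ ≤ ‖(Fin.cons p P : Fin (k + 1) → E n)‖ ^ (N + i) * ‖ψ (Fin.cons p P)‖ := by
        rw [pow_add]
        gcongr
        · exact norm_head_le_norm_cons p P
        · exact norm_tail_le_norm_cons p P
    _ ≤ C i := by simpa only [norm_iteratedFDeriv_zero] using hC i (Fin.cons p P)
    _ ≤ ∑ i ∈ Finset.range (M + 1), C i :=
        Finset.single_le_sum (fun i _ => (hC0 i).le) (Finset.mem_range.2 (Nat.lt_succ_of_le hi))

/-- The slices of a Schwartz function, as an `L²`-valued Schwartz map. -/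
noncomputable def sliceSchwartz (k : ℕ) (ψ : 𝓢(Fin (k + 1) → E n, ℂ)) :
    𝓢(E n, Lp ℂ 2 (muPi n m k)) :=
  schwartzOfFamily (F := sliceLp m k) (D := fun j ψ => axisDeriv 0 j ψ)
    (hasFDerivAt_sliceLp m k) (sliceLp_decay m k) ψ

lemma sliceSchwartz_apply (k : ℕ) (ψ : 𝓢(Fin (k + 1) → E n, ℂ)) (p : E n) :
    sliceSchwartz m k ψ p = (slice p k ψ).toLp 2 (muPi n m k) := rfl

lemma lineDerivOp_sliceSchwartz (k : ℕ) (ψ : 𝓢(Fin (k + 1) → E n, ℂ)) (j : Fin n) :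
    ∂_{(EuclideanSpace.single j 1 : E n)} (sliceSchwartz m k ψ)
      = sliceSchwartz m k (axisDeriv 0 j ψ) := by
  ext1 p
  rw [SchwartzMap.lineDerivOp_apply_eq_fderiv]
  have h : fderiv ℝ (sliceSchwartz m k ψ) p = _ := (hasFDerivAt_sliceLp m k ψ p).fderiv
  rw [h, gradCLM_single]
  rfl

end SliceLp

/-! ### Matrix elements in the Fock space -/

section Omega

variable {n : ℕ}

lemma omega_pos {m : ℝ} (hm : 0 < m) (p : E n) : 0 < omega m p :=
  Real.sqrt_pos.2 (by positivity)

lemma omega_sq (m : ℝ) (p : E n) : omega m p ^ 2 = ‖p‖ ^ 2 + m ^ 2 :=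
  Real.sq_sqrt (by positivity)

lemma continuous_omega (m : ℝ) : Continuous (omega (n := n) m) := by
  unfold omega
  fun_prop

end Omega

section FockIncl

variable {n : ℕ} (m : ℝ)

/-- Symmetrization, followed by the inclusion of the `k`-particle space into the Fock space. -/
noncomputable def fockIncl (n : ℕ) (k : ℕ) : Lp ℂ 2 (muPi n m k) →L[ℂ] FockSpace n m :=
  (lp.singleContinuousLinearMap ℂ (fun k : ℕ => kParticle n m k) 2 k).comp
    (kParticle n m k).orthogonalProjectionOnto

lemma fockIncl_apply {k : ℕ} {u : Lp ℂ 2 (muPi n m k)} (hu : u ∈ kParticle n m k) :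
    fockIncl m n k u = lp.single (E := fun k : ℕ => kParticle n m k) 2 k ⟨u, hu⟩ :=
  congrArg (lp.single (E := fun k : ℕ => kParticle n m k) 2 k)
    ((kParticle n m k).orthogonalProjectionOnto_mem_subspace_eq_self ⟨u, hu⟩)

lemma inner_fockIncl {k l : ℕ} {u : Lp ℂ 2 (muPi n m k)} (hu : u ∈ kParticle n m k)
    (v : (l : ℕ) → Lp ℂ 2 (muPi n m l)) :
    ⟪fockIncl m n k u, fockIncl m n l (v l)⟫_ℂ = if k = l then ⟪u, v k⟫_ℂ else 0 := by
  have hleft : ⟪fockIncl m n k u, fockIncl m n l (v l)⟫_ℂ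
      = ⟪(⟨u, hu⟩ : kParticle n m k), (lp.single (E := fun k : ℕ => kParticle n m k) 2 l
        ((kParticle n m l).orthogonalProjectionOnto (v l))) k⟫_ℂ := by
    rw [fockIncl_apply m hu]
    exact lp.inner_single_left _ _ _
  rw [hleft]
  split_ifs with hkl
  · subst hkl
    rw [lp.single_apply_self, Submodule.inner_orthogonalProjectionOnto_eq_of_mem_left]
  · rw [lp.single_apply_ne _ _ _ hkl, inner_zero_right]

lemma inner_sum_fockIncl (S : Finset ℕ) (u v : (k : ℕ) → Lp ℂ 2 (muPi n m k))
    (hu : ∀ k, u k ∈ kParticle n m k) :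
    ⟪∑ k ∈ S, fockIncl m n k (u k), ∑ k ∈ S, fockIncl m n k (v k)⟫_ℂ
      = ∑ k ∈ S, ⟪u k, v k⟫_ℂ := by
  rw [sum_inner]
  refine Finset.sum_congr rfl fun k hk => ?_
  simp_rw [inner_sum, inner_fockIncl m (hu k) v]
  rw [Finset.sum_ite_eq, if_pos hk]

end FockIncl

lemma exists_particle_bound {n : ℕ} (X : SchwartzDomain n) : ∃ N : ℕ, ∀ k, N ≤ k → X.1 k = 0 := by
  obtain ⟨N, hN⟩ := X.2.1.bddAbove
  exact ⟨N + 1, fun k hk => not_not.1 fun hne => absurd (hN hne) (by omega)⟩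

section ToFock

variable {n : ℕ} (m : ℝ) [Fact (0 < m)]

lemma toFock_eq_sum {N : ℕ} {X : SchwartzDomain n} (hN : ∀ k, N ≤ k → X.1 k = 0) :
    toFock m X = ∑ k ∈ Finset.range N, fockIncl m n k ((X.1 k).toLp 2 (muPi n m k)) := by
  set x : (k : ℕ) → kParticle n m k := fun k => ⟨_, toLp_mem_kParticle X k⟩
  have hx : ∀ k ∉ Finset.range N, x k = 0 := fun k hk => Subtype.ext <| by
    change SchwartzMap.toLpCLM ℂ ℂ 2 (muPi n m k) (X.1 k) = 0
    rw [hN k (by simpa using hk), map_zero]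
  simp_rw [fun k => fockIncl_apply m (toLp_mem_kParticle X k)]
  refine lp.ext (E := fun k : ℕ => kParticle n m k) (funext fun k => ?_)
  calc x k = ∑ l ∈ Finset.range N, Pi.single l (x l) k := by
        rw [Finset.sum_pi_single]
        split_ifs with hk
        · rfl
        · exact hx k hk
    _ = (∑ l ∈ Finset.range N, lp.single (E := fun k : ℕ => kParticle n m k) 2 l (x l) :
          lp (fun k : ℕ => kParticle n m k) 2) k := by
        rw [lp.coeFn_sum, Finset.sum_apply]
        rfl

lemma isOpenPosMeasure_muMeas : (muMeas n m).IsOpenPosMeasure := by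
  refine (withDensity_absolutelyContinuous' ?_ ?_).isOpenPosMeasure
    (μ := (volume : Measure (E n)))
  · have := continuous_omega (n := n) m
    exact Measurable.aemeasurable (by fun_prop)
  · exact Eventually.of_forall fun p => by simpa using omega_pos Fact.out p

lemma toFock_injective : Function.Injective (toFock m : SchwartzDomain n →ₗ[ℂ] FockSpace n m) := by
  intro X Y h
  refine Subtype.ext (funext fun k => ?_)
  have := isOpenPosMeasure_muMeas (n := n) m
  have : (muPi n m k).IsOpenPosMeasure := by unfold muPi; infer_instance
  exact SchwartzMap.injective_toLp 2 (muPi n m k) <|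
    congrArg (fun F : FockSpace n m => ((F.1 k : kParticle n m k) : Lp ℂ 2 (muPi n m k))) h

lemma eq_of_inner_toFock {T T' : SchwartzDomain n →ₗ[ℂ] SchwartzDomain n}
    (h : ∀ Φ Ψ, ⟪toFock m Φ, toFock m (T Ψ)⟫_ℂ = ⟪toFock m Φ, toFock m (T' Ψ)⟫_ℂ) : T = T' := by
  refine LinearMap.ext fun Ψ => toFock_injective m (sub_eq_zero.1 ?_)
  have hself := h (T Ψ - T' Ψ) Ψ
  rw [← sub_eq_zero, ← inner_sub_right, map_sub] at hself
  exact inner_self_eq_zero.1 hself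

end ToFock

/-! ### The annihilation operators as Fock space valued Schwartz maps -/

section SchwartzLemmas

variable {X V : Type*} [NormedAddCommGroup X] [NormedSpace ℝ X]

lemma lineDerivOp_postcompCLM {W : Type*} [NormedAddCommGroup V] [NormedSpace ℂ V]
    [NormedSpace ℝ V] [IsScalarTower ℝ ℂ V] [NormedAddCommGroup W] [NormedSpace ℂ W]
    (L : V →L[ℂ] W) (f : 𝓢(X, V)) (v : X) :
    ∂_{v} (SchwartzMap.postcompCLM L f) = SchwartzMap.postcompCLM L (∂_{v} f) := by
  ext1 p
  rw [SchwartzMap.postcompCLM_apply, SchwartzMap.lineDerivOp_apply_eq_fderiv,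
    SchwartzMap.lineDerivOp_apply_eq_fderiv]
  exact congrArg (fun T : X →L[ℝ] W => T v)
    ((L.restrictScalars ℝ).hasFDerivAt.comp p (f.hasFDerivAt p)).fderiv

lemma integrable_inner_schwartz [NormedAddCommGroup V] [InnerProductSpace ℂ V] [NormedSpace ℝ V]
    [MeasurableSpace X] [BorelSpace X] [SecondCountableTopology X] {μ : Measure X}
    [μ.HasTemperateGrowth] (f g : 𝓢(X, V)) : Integrable (fun p => ⟪f p, g p⟫_ℂ) μ := by
  obtain ⟨C, -, hC⟩ := f.decay 0 0
  refine (g.integrable.norm.const_mul C).mono'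
    (f.continuous.inner g.continuous).aestronglyMeasurable (Eventually.of_forall fun p => ?_)
  have hf : ‖f p‖ ≤ C := by simpa only [pow_zero, one_mul, norm_iteratedFDeriv_zero] using hC p
  exact (norm_inner_le_norm _ _).trans (by gcongr)

end SchwartzLemmas

section Annihilation

variable {n : ℕ} (m : ℝ) [Fact (0 < m)]

/-- The Fock space valued Schwartz map `p ↦ ∑_{k<N} √(k+1) ψ_k(p, ·)`; the symmetrization in
`fockIncl` matters because `ψ_k(p, ·)` need not be symmetric. -/
noncomputable def sliceSum (N : ℕ) (ψ : (k : ℕ) → 𝓢(Fin (k + 1) → E n, ℂ)) :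
    𝓢(E n, FockSpace n m) :=
  ∑ k ∈ Finset.range N, SchwartzMap.postcompCLM (fockIncl m n k)
    (((Real.sqrt (k + 1) : ℝ) : ℂ) • sliceSchwartz m k (ψ k))

lemma sliceSum_apply (N : ℕ) (ψ : (k : ℕ) → 𝓢(Fin (k + 1) → E n, ℂ)) (p : E n) :
    sliceSum m N ψ p = ∑ k ∈ Finset.range N,
      fockIncl m n k (((Real.sqrt (k + 1) : ℝ) : ℂ) • sliceSchwartz m k (ψ k) p) := by
  simp [sliceSum]

lemma lineDerivOp_sliceSum (N : ℕ) (ψ : (k : ℕ) → 𝓢(Fin (k + 1) → E n, ℂ)) (j : Fin n) :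
    ∂_{(EuclideanSpace.single j 1 : E n)} (sliceSum m N ψ)
      = sliceSum m N fun k => axisDeriv 0 j (ψ k) := by
  unfold sliceSum
  rw [LineDeriv.lineDerivOp_sum]
  refine Finset.sum_congr rfl fun k _ => ?_
  rw [lineDerivOp_postcompCLM, LineDeriv.lineDerivOp_smul, lineDerivOp_sliceSchwartz]

/-- The Fock space valued Schwartz map `p ↦ a_c(p)Ψ`; the number of terms is any bound on the
number of particles in `Ψ`. -/
noncomputable def annCov (Ψ : SchwartzDomain n) : 𝓢(E n, FockSpace n m) :=
  sliceSum m (exists_particle_bound Ψ).choose fun k => Ψ.1 (k + 1)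

lemma toLp_annihilationCov (Ψ : SchwartzDomain n) (k : ℕ) (p : E n) :
    ((annihilationCov p Ψ).1 k).toLp 2 (muPi n m k)
      = ((Real.sqrt (k + 1) : ℝ) : ℂ) • sliceSchwartz m k (Ψ.1 (k + 1)) p :=
  (SchwartzMap.toLpCLM ℂ ℂ 2 (muPi n m k)).map_smul _ _

lemma sliceSum_eq_toFock {N : ℕ} {Ψ : SchwartzDomain n} (hN : ∀ k, N ≤ k → Ψ.1 k = 0) (p : E n) :
    sliceSum m N (fun k => Ψ.1 (k + 1)) p = toFock m (annihilationCov p Ψ) := by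
  have hN' : ∀ k, N ≤ k → (annihilationCov p Ψ).1 k = 0 := fun k hk => by
    change ((Real.sqrt (k + 1) : ℝ) : ℂ) • slice p k (Ψ.1 (k + 1)) = 0
    rw [hN (k + 1) (by omega), map_zero, smul_zero]
  simp_rw [toFock_eq_sum m hN', sliceSum_apply, toLp_annihilationCov]

lemma annCov_apply (Ψ : SchwartzDomain n) (p : E n) :
    annCov m Ψ p = toFock m (annihilationCov p Ψ) :=
  sliceSum_eq_toFock m (exists_particle_bound Ψ).choose_spec p

lemma annCov_eq_sliceSum {N : ℕ} {Ψ : SchwartzDomain n} (hN : ∀ k, N ≤ k → Ψ.1 k = 0) :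
    annCov m Ψ = sliceSum m N fun k => Ψ.1 (k + 1) := by
  ext1 p
  rw [annCov_apply, sliceSum_eq_toFock m hN]

lemma smul_sliceSchwartz_mem_kParticle (Ψ : SchwartzDomain n) (k : ℕ) (p : E n) :
    ((Real.sqrt (k + 1) : ℝ) : ℂ) • sliceSchwartz m k (Ψ.1 (k + 1)) p ∈ kParticle n m k :=
  toLp_annihilationCov m Ψ k p ▸ toLp_mem_kParticle (m := m) (annihilationCov p Ψ) k

lemma inner_annCov_sliceSum {N : ℕ} {Φ : SchwartzDomain n} (hN : ∀ k, N ≤ k → Φ.1 k = 0)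
    (ψ : (k : ℕ) → 𝓢(Fin (k + 1) → E n, ℂ)) (p : E n) :
    ⟪annCov m Φ p, sliceSum m N ψ p⟫_ℂ = ∑ k ∈ Finset.range N, ((k : ℂ) + 1) *
      ⟪sliceSchwartz m k (Φ.1 (k + 1)) p, sliceSchwartz m k (ψ k) p⟫_ℂ := by
  rw [annCov_eq_sliceSum m hN, sliceSum_apply, sliceSum_apply, inner_sum_fockIncl m _ _ _
    fun k => smul_sliceSchwartz_mem_kParticle m Φ k p]
  refine Finset.sum_congr rfl fun k _ => ?_
  rw [inner_smul_left, inner_smul_right, Complex.conj_ofReal, ← mul_assoc, ← Complex.ofReal_mul,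
    Real.mul_self_sqrt (by positivity)]
  push_cast
  rfl

end Annihilation

/-! ### Second quantized vector fields -/

section VectorFields

variable {n k : ℕ} {g : E n → ℂ} (j : Fin n)

lemma hasTemperateGrowth_comp_proj (hg : g.HasTemperateGrowth) (l : Fin k) :
    Function.HasTemperateGrowth fun P : Fin k → E n => g (P l) :=
  hg.comp (ContinuousLinearMap.proj (R := ℝ) (φ := fun _ : Fin k => E n) l).hasTemperateGrowth

/-- The vector field `g ∂/∂p^j` acting on the `l`-th momentum. -/
noncomputable def fieldAt (g : E n → ℂ) (j : Fin n) (l : Fin k) :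
    𝓢(Fin k → E n, ℂ) →L[ℂ] 𝓢(Fin k → E n, ℂ) :=
  (SchwartzMap.smulLeftCLM ℂ fun P : Fin k → E n => g (P l)).comp (axisDeriv l j)

lemma fieldAt_apply (hg : g.HasTemperateGrowth) (l : Fin k) (ψ : 𝓢(Fin k → E n, ℂ))
    (P : Fin k → E n) : fieldAt g j l ψ P = g (P l) * axisDeriv l j ψ P := by
  rw [fieldAt, ContinuousLinearMap.comp_apply,
    SchwartzMap.smulLeftCLM_apply_apply (hasTemperateGrowth_comp_proj hg l), smul_eq_mul]

lemma axis_comp_perm (σ : Equiv.Perm (Fin k)) (l : Fin k) :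
    (axis (σ l) j : Fin k → E n) ∘ σ = axis l j := by
  ext1 i
  obtain rfl | hi := eq_or_ne i l
  · simp [axis]
  · simp [axis, hi]

lemma axisDeriv_perm {ψ : 𝓢(Fin k → E n, ℂ)} (σ : Equiv.Perm (Fin k))
    (hψ : ∀ P, ψ (P ∘ σ) = ψ P) (l : Fin k) (P : Fin k → E n) :
    axisDeriv l j ψ (P ∘ σ) = axisDeriv (σ l) j ψ P := by
  let L : (Fin k → E n) →L[ℝ] (Fin k → E n) :=
    ContinuousLinearMap.pi fun i => ContinuousLinearMap.proj (σ i)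
  have hcomp : HasFDerivAt (ψ ∘ L) ((fderiv ℝ ψ (P ∘ σ)).comp L) P :=
    HasFDerivAt.comp P (f := L) (g := ψ) (ψ.hasFDerivAt (L P)) L.hasFDerivAt
  have hsymm : (ψ ∘ L : (Fin k → E n) → ℂ) = ψ := funext hψ
  rw [hsymm] at hcomp
  rw [axisDeriv_apply, axisDeriv_apply, hcomp.fderiv, ContinuousLinearMap.comp_apply,
    ← axis_comp_perm j σ l]
  rfl

lemma fieldAt_perm (hg : g.HasTemperateGrowth) {ψ : 𝓢(Fin k → E n, ℂ)} (σ : Equiv.Perm (Fin k))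
    (hψ : ∀ P, ψ (P ∘ σ) = ψ P) (l : Fin k) (P : Fin k → E n) :
    fieldAt g j l ψ (P ∘ σ) = fieldAt g j (σ l) ψ P := by
  rw [fieldAt_apply j hg, fieldAt_apply j hg, axisDeriv_perm j σ hψ, Function.comp_apply]

/-- The second quantization `∑_l g(p_l) ∂/∂p_l^j` of the vector field `g ∂/∂p^j`. -/
noncomputable def dGamma (hg : g.HasTemperateGrowth) : SchwartzDomain n →ₗ[ℂ] SchwartzDomain n where
  toFun Ψ := ⟨fun k => ∑ l : Fin k, fieldAt g j l (Ψ.1 k), by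
    refine ⟨Ψ.2.1.subset fun k hk hc => hk (by simp [hc]), fun k σ P => ?_⟩
    simp_rw [sum_apply, fieldAt_perm j hg σ (Ψ.2.2 k σ)]
    exact Equiv.sum_comp σ fun l => fieldAt g j l (Ψ.1 k) P⟩
  map_add' Ψ Φ := Subtype.ext (funext fun k => by simp [Finset.sum_add_distrib])
  map_smul' c Ψ := Subtype.ext (funext fun k => by simp [Finset.smul_sum])

lemma dGamma_apply (hg : g.HasTemperateGrowth) (Ψ : SchwartzDomain n) (k : ℕ) :
    (dGamma j hg Ψ).1 k = ∑ l : Fin k, fieldAt g j l (Ψ.1 k) := rfl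

lemma integral_inner_dGamma_zero (m : ℝ) (hg : g.HasTemperateGrowth) (Φ Ψ : SchwartzDomain n) :
    ∫ Z, ⟪Φ.1 0 Z, (dGamma j hg Ψ).1 0 Z⟫_ℂ ∂(muPi n m 0) = 0 := by
  simp [dGamma_apply]

lemma integral_inner_fieldAt (m : ℝ) (hg : g.HasTemperateGrowth) (Φ Ψ : SchwartzDomain n) (k : ℕ)
    (l : Fin (k + 1)) :
    ∫ Z, ⟪Φ.1 (k + 1) Z, fieldAt g j l (Ψ.1 (k + 1)) Z⟫_ℂ ∂(muPi n m (k + 1))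
      = ∫ Z, ⟪Φ.1 (k + 1) Z, fieldAt g j 0 (Ψ.1 (k + 1)) Z⟫_ℂ ∂(muPi n m (k + 1)) := by
  have hσ := measurePreserving_perm (n := n) m (k + 1) (Equiv.swap 0 l)
  have hc : Continuous fun Z => ⟪Φ.1 (k + 1) Z, fieldAt g j 0 (Ψ.1 (k + 1)) Z⟫_ℂ :=
    (Φ.1 (k + 1)).continuous.inner (fieldAt g j 0 (Ψ.1 (k + 1))).continuous
  have hswap := integral_map hσ.aemeasurable
    (hc.aestronglyMeasurable (μ := (muPi n m (k + 1)).map _))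
  rw [hσ.map_eq] at hswap
  rw [hswap]
  refine integral_congr_ae (Eventually.of_forall fun Z => ?_)
  beta_reduce
  rw [Φ.2.2, fieldAt_perm j hg _ (Ψ.2.2 _ _), Equiv.swap_apply_left]

end VectorFields

section MassShellMeasure

variable {n : ℕ} (m : ℝ)

lemma integral_muMeas (f : E n → ℂ) :
    ∫ p, f p ∂(muMeas n m) = ∫ p, (((2 * omega m p)⁻¹ : ℝ) : ℂ) * f p := by
  have hω := continuous_omega (n := n) m
  rw [muMeas, integral_withDensity_eq_integral_toReal_smul (by fun_prop)
    (Eventually.of_forall fun p => ENNReal.ofReal_lt_top)]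
  refine integral_congr_ae (Eventually.of_forall fun p => ?_)
  have hωp : 0 ≤ omega m p := Real.sqrt_nonneg _
  beta_reduce
  rw [ENNReal.toReal_ofReal (by positivity), Complex.real_smul, one_div]

variable [Fact (0 < m)]

lemma integral_muPi_succ {k : ℕ} (φ χ : 𝓢(Fin (k + 1) → E n, ℂ)) :
    ∫ Z, ⟪φ Z, χ Z⟫_ℂ ∂(muPi n m (k + 1))
      = ∫ p, (((2 * omega m p)⁻¹ : ℝ) : ℂ) * ⟪sliceSchwartz m k φ p, sliceSchwartz m k χ p⟫_ℂ := by
  have hmp := (measurePreserving_piFinSuccAbove (α := fun _ : Fin (k + 1) => E n)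
    (fun _ => muMeas n m) 0).symm
  have hint := (hmp.integrable_comp_emb (MeasurableEquiv.measurableEmbedding _)).2
    (integrable_inner_schwartz (μ := muPi n m (k + 1)) φ χ)
  have hsplit : ∀ (p : E n) (P : Fin k → E n),
      (MeasurableEquiv.piFinSuccAbove (fun _ : Fin (k + 1) => E n) 0).symm (p, P)
        = Fin.cons p P := fun p P => by
    ext1 i
    refine Fin.cases ?_ (fun i => ?_) i <;> simp [MeasurableEquiv.piFinSuccAbove]
  refine (hmp.integral_comp' (g := fun Z => ⟪φ Z, χ Z⟫_ℂ)).symm.trans ?_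
  refine (integral_prod _ hint).trans ?_
  rw [integral_muMeas]
  refine integral_congr_ae (Eventually.of_forall fun p => congrArg _ ?_)
  rw [sliceSchwartz_apply, sliceSchwartz_apply, SchwartzMap.inner_toL2_toL2_eq _ _ (muPi n m k)]
  refine integral_congr_ae (Eventually.of_forall fun P => ?_)
  simp only [Function.comp_apply, hsplit, slice_apply]

lemma integrable_inv_omega_mul {f : E n → ℂ} (hf : Integrable f) :
    Integrable fun p => (((2 * omega m p)⁻¹ : ℝ) : ℂ) * f p := by
  have hm : 0 < m := Fact.out
  have hcont : Continuous fun p : E n => (((2 * omega m p)⁻¹ : ℝ) : ℂ) :=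
    Complex.continuous_ofReal.comp ((continuous_const.mul (continuous_omega m)).inv₀ fun p =>
      (mul_pos two_pos (omega_pos hm p)).ne')
  refine (hf.norm.const_mul (2 * m)⁻¹).mono'
    (hcont.aestronglyMeasurable.mul hf.aestronglyMeasurable) (Eventually.of_forall fun p => ?_)
  have hmω : m ≤ omega m p := Real.le_sqrt_of_sq_le (by nlinarith [sq_nonneg ‖p‖])
  have hωp := omega_pos hm p
  rw [norm_mul, Complex.norm_real, Real.norm_of_nonneg (by positivity)]
  gcongr

lemma integrable_inv_omega_mul_inner {V : Type*} [NormedAddCommGroup V] [InnerProductSpace ℂ V]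
    {g : E n → ℂ} (hg : g.HasTemperateGrowth) (f h : 𝓢(E n, V)) :
    Integrable fun p => (((2 * omega m p)⁻¹ : ℝ) : ℂ) * (g p * ⟪f p, h p⟫_ℂ) := by
  refine integrable_inv_omega_mul m ((integrable_inner_schwartz f
    (SchwartzMap.smulLeftCLM V g h)).congr (Eventually.of_forall fun p => ?_))
  beta_reduce
  rw [SchwartzMap.smulLeftCLM_apply_apply hg, inner_smul_right]

end MassShellMeasure

section SecondQuantization

variable {n : ℕ} (m : ℝ) [Fact (0 < m)] {g : E n → ℂ} (j : Fin n)

lemma sliceSchwartz_fieldAt (hg : g.HasTemperateGrowth) {k : ℕ} (ψ : 𝓢(Fin (k + 1) → E n, ℂ))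
    (p : E n) :
    sliceSchwartz m k (fieldAt g j 0 ψ) p = g p • sliceSchwartz m k (axisDeriv 0 j ψ) p := by
  have hslice : slice p k (fieldAt g j 0 ψ) = g p • slice p k (axisDeriv 0 j ψ) := by
    ext1 P
    rw [slice_apply, fieldAt_apply j hg, smul_apply, slice_apply, Fin.cons_zero, smul_eq_mul]
  rw [sliceSchwartz_apply, hslice]
  exact (SchwartzMap.toLpCLM ℂ ℂ 2 (muPi n m k)).map_smul _ _

lemma inner_toFock_eq_sum {N : ℕ} {Φ Ψ : SchwartzDomain n} (hΦ : ∀ k, N ≤ k → Φ.1 k = 0)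
    (hΨ : ∀ k, N ≤ k → Ψ.1 k = 0) :
    ⟪toFock m Φ, toFock m Ψ⟫_ℂ = ∑ k ∈ Finset.range N, ∫ Z, ⟪Φ.1 k Z, Ψ.1 k Z⟫_ℂ ∂(muPi n m k) := by
  rw [toFock_eq_sum m hΦ, toFock_eq_sum m hΨ, inner_sum_fockIncl m _ _ _ (toLp_mem_kParticle Φ)]
  exact Finset.sum_congr rfl fun k _ => SchwartzMap.inner_toL2_toL2_eq _ _ (muPi n m k)

/-- By symmetry all `k + 1` summands of `dGamma` contribute equally. -/
lemma integral_inner_dGamma_succ (hg : g.HasTemperateGrowth) (Φ Ψ : SchwartzDomain n) (k : ℕ) :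
    ∫ Z, ⟪Φ.1 (k + 1) Z, (dGamma j hg Ψ).1 (k + 1) Z⟫_ℂ ∂(muPi n m (k + 1))
      = ∫ p, (((2 * omega m p)⁻¹ : ℝ) : ℂ) * (g p * (((k : ℂ) + 1) *
        ⟪sliceSchwartz m k (Φ.1 (k + 1)) p,
          sliceSchwartz m k (axisDeriv 0 j (Ψ.1 (k + 1))) p⟫_ℂ)) := by
  simp_rw [dGamma_apply, sum_apply, inner_sum]
  rw [integral_finsetSum _ fun l _ => integrable_inner_schwartz _ _]
  simp_rw [integral_inner_fieldAt j m hg Φ Ψ k]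
  rw [Finset.sum_const, Finset.card_univ, Fintype.card_fin, nsmul_eq_mul, integral_muPi_succ,
    ← integral_const_mul]
  refine integral_congr_ae (Eventually.of_forall fun p => ?_)
  beta_reduce
  rw [sliceSchwartz_fieldAt m j hg, inner_smul_right]
  push_cast
  ring

theorem inner_toFock_dGamma (hg : g.HasTemperateGrowth) (Φ Ψ : SchwartzDomain n) :
    ⟪toFock m Φ, toFock m (dGamma j hg Ψ)⟫_ℂ = ∫ p, (((2 * omega m p)⁻¹ : ℝ) : ℂ) *
      (g p * ⟪annCov m Φ p, ∂_{(EuclideanSpace.single j 1 : E n)} (annCov m Ψ) p⟫_ℂ) := by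
  obtain ⟨N₁, h₁⟩ := exists_particle_bound Φ
  obtain ⟨N₂, h₂⟩ := exists_particle_bound Ψ
  set N := max N₁ N₂
  have hΦ : ∀ k, N ≤ k → Φ.1 k = 0 := fun k hk => h₁ k ((le_max_left _ _).trans hk)
  have hΨ : ∀ k, N ≤ k → Ψ.1 k = 0 := fun k hk => h₂ k ((le_max_right _ _).trans hk)
  have hdGamma : ∀ k, N + 1 ≤ k → (dGamma j hg Ψ).1 k = 0 := fun k hk => by
    rw [dGamma_apply, hΨ k (by omega)]
    simp
  have hint (k : ℕ) : Integrable fun p => (((2 * omega m p)⁻¹ : ℝ) : ℂ) * (g p * (((k : ℂ) + 1) *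
      ⟪sliceSchwartz m k (Φ.1 (k + 1)) p,
        sliceSchwartz m k (axisDeriv 0 j (Ψ.1 (k + 1))) p⟫_ℂ)) :=
    (integrable_inv_omega_mul_inner m (hg.mul (.const ((k : ℂ) + 1))) _ _).congr
      (Eventually.of_forall fun p => congrArg _ (mul_assoc _ _ _))
  rw [inner_toFock_eq_sum m (fun k (hk : N + 1 ≤ k) => hΦ k (by omega)) hdGamma,
    Finset.sum_range_succ', integral_inner_dGamma_zero, add_zero]
  simp_rw [integral_inner_dGamma_succ]
  rw [← integral_finsetSum _ fun k _ => hint k]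
  refine integral_congr_ae (Eventually.of_forall fun p => ?_)
  beta_reduce
  rw [annCov_eq_sliceSum m hΨ, lineDerivOp_sliceSum, inner_annCov_sliceSum m hΦ, ← Finset.mul_sum,
    ← Finset.mul_sum]

end SecondQuantization

/-! ### The generators in momentum space -/

section Energy

variable {n : ℕ}

lemma hasTemperateGrowth_coord (j : Fin n) :
    Function.HasTemperateGrowth fun p : E n => ((p j : ℝ) : ℂ) :=
  Function.Complex.hasTemperateGrowth_ofReal.comp
    (EuclideanSpace.proj j : E n →L[ℝ] ℝ).hasTemperateGrowth

lemma inv_sqrt_omega_mul_self (m : ℝ) (p : E n) :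
    (((Real.sqrt (2 * omega m p))⁻¹ : ℝ) : ℂ) * (((Real.sqrt (2 * omega m p))⁻¹ : ℝ) : ℂ)
      = (((2 * omega m p)⁻¹ : ℝ) : ℂ) := by
  have hω : 0 ≤ omega m p := Real.sqrt_nonneg _
  rw [← Complex.ofReal_mul, ← mul_inv, Real.mul_self_sqrt (mul_nonneg zero_le_two hω)]

variable (m : ℝ) [Fact (0 < m)]

lemma hasTemperateGrowth_norm_sq_add_rpow (s : ℝ) :
    Function.HasTemperateGrowth fun p : E n => (‖p‖ ^ 2 + m ^ 2) ^ s := by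
  have hm : 0 < m := Fact.out
  have hscale : (fun p : E n => (‖p‖ ^ 2 + m ^ 2) ^ s)
      = fun p : E n => (m ^ 2) ^ s * (1 + ‖m⁻¹ • p‖ ^ 2) ^ s := by
    funext p
    rw [← Real.mul_rpow (by positivity) (by positivity), norm_smul,
      Real.norm_of_nonneg (by positivity)]
    congr 1
    field_simp
    ring
  rw [hscale]
  exact (Function.HasTemperateGrowth.const _).mul <|
    (Function.hasTemperateGrowth_one_add_norm_sq_rpow (E n) s).comp
      (m⁻¹ • ContinuousLinearMap.id ℝ (E n)).hasTemperateGrowth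

lemma hasTemperateGrowth_omega : Function.HasTemperateGrowth fun p : E n => (omega m p : ℂ) := by
  simp_rw [omega, Real.sqrt_eq_rpow]
  exact Function.Complex.hasTemperateGrowth_ofReal.comp (hasTemperateGrowth_norm_sq_add_rpow m _)

lemma hasTemperateGrowth_inv_sqrt_omega :
    Function.HasTemperateGrowth fun p : E n => (((Real.sqrt (2 * omega m p))⁻¹ : ℝ) : ℂ) := by
  have hrpow : ∀ p : E n, (Real.sqrt (2 * omega m p))⁻¹
      = (Real.sqrt 2)⁻¹ * (‖p‖ ^ 2 + m ^ 2) ^ (-(1 / 4) : ℝ) := fun p => by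
    have h0 : (0 : ℝ) ≤ ‖p‖ ^ 2 + m ^ 2 := by positivity
    rw [Real.sqrt_mul zero_le_two, omega, Real.sqrt_eq_rpow (‖p‖ ^ 2 + m ^ 2),
      Real.sqrt_eq_rpow (_ ^ (_ : ℝ)), ← Real.rpow_mul h0, mul_inv, ← Real.rpow_neg h0]
    norm_num
  simp_rw [hrpow]
  exact Function.Complex.hasTemperateGrowth_ofReal.comp
    ((Function.HasTemperateGrowth.const _).mul (hasTemperateGrowth_norm_sq_add_rpow m _))

lemma hasFDerivAt_omega (p : E n) :
    HasFDerivAt (omega m : E n → ℝ) ((omega m p)⁻¹ • innerSL ℝ p) p := by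
  have hp := omega_pos (n := n) (Fact.out : 0 < m) p
  have hsq : HasFDerivAt (fun p : E n => ‖p‖ ^ 2 + m ^ 2) (2 • innerSL ℝ p) p :=
    (hasStrictFDerivAt_norm_sq p).hasFDerivAt.add_const _
  have hne : ‖p‖ ^ 2 + m ^ 2 ≠ 0 := by rw [← omega_sq]; positivity
  refine (hsq.sqrt hne).congr_fderiv ?_
  ext v
  change (1 / (2 * omega m p)) • ((2 • innerSL ℝ p) v) = (omega m p)⁻¹ • (innerSL ℝ p v)
  simp only [smul_apply, smul_eq_mul, nsmul_eq_mul]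
  push_cast
  field_simp

lemma hasFDerivAt_inv_sqrt_omega (p : E n) :
    HasFDerivAt (fun p : E n => (Real.sqrt (2 * omega m p))⁻¹)
      (-((Real.sqrt (2 * omega m p))⁻¹ / (2 * omega m p ^ 2)) • innerSL ℝ p) p := by
  have hp := omega_pos (n := n) (Fact.out : 0 < m) p
  have hs : 0 < Real.sqrt (2 * omega m p) := Real.sqrt_pos.2 (by positivity)
  have hsq : Real.sqrt (2 * omega m p) ^ 2 = 2 * omega m p := Real.sq_sqrt (by positivity)
  refine ((hasDerivAt_inv hs.ne').comp_hasFDerivAt p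
    (((hasFDerivAt_omega m p).const_mul 2).sqrt (by positivity))).congr_fderiv ?_
  ext v
  simp only [smul_apply, smul_eq_mul]
  rw [hsq]
  field_simp

end Energy

section AnnSchwartz

variable {n : ℕ} (m : ℝ) [Fact (0 < m)]

/-- The Fock space valued Schwartz map `p ↦ a(p)Ψ`. -/
noncomputable def annSchwartz (Ψ : SchwartzDomain n) : 𝓢(E n, FockSpace n m) :=
  SchwartzMap.smulLeftCLM (FockSpace n m)
    (fun p : E n => (((Real.sqrt (2 * omega m p))⁻¹ : ℝ) : ℂ)) (annCov m Ψ)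

lemma annSchwartz_apply (Ψ : SchwartzDomain n) (p : E n) : annSchwartz m Ψ p = ann m p Ψ := by
  rw [annSchwartz, SchwartzMap.smulLeftCLM_apply_apply (hasTemperateGrowth_inv_sqrt_omega m),
    annCov_apply, ann]

lemma coe_annSchwartz (Ψ : SchwartzDomain n) :
    (annSchwartz m Ψ : E n → FockSpace n m) = fun p => ann m p Ψ :=
  funext (annSchwartz_apply m Ψ)

lemma partialDeriv_ann (Ψ : SchwartzDomain n) (j : Fin n) (p : E n) :
    partialDeriv j (fun q => ann m q Ψ) p = (((Real.sqrt (2 * omega m p))⁻¹ : ℝ) : ℂ) •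
      (∂_{(EuclideanSpace.single j 1 : E n)} (annCov m Ψ) p
        - ((p j / (2 * omega m p ^ 2) : ℝ) : ℂ) • annCov m Ψ p) := by
  have hann : (fun q => ann m q Ψ)
      = fun q : E n => (Real.sqrt (2 * omega m q))⁻¹ • annCov m Ψ q := by
    funext q
    rw [ann, annCov_apply, Complex.coe_smul]
  have hderiv := ((hasFDerivAt_inv_sqrt_omega m p).smul ((annCov m Ψ).hasFDerivAt p)).fderiv
  rw [partialDeriv, hann, SchwartzMap.lineDerivOp_apply_eq_fderiv]
  refine (congrArg (fun T : E n →L[ℝ] FockSpace n m => T (EuclideanSpace.single j 1))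
    hderiv).trans ?_
  simp only [add_apply, smul_apply, ContinuousLinearMap.smulRight_apply, innerSL_apply_apply,
    EuclideanSpace.inner_single_right, one_mul, conj_trivial, smul_eq_mul, smul_sub,
    ← Complex.coe_smul, smul_smul]
  push_cast
  match_scalars <;> ring

lemma inner_ann_smul (Φ : SchwartzDomain n) (p : E n) (c : ℂ) (v : FockSpace n m) :
    ⟪ann m p Φ, ((((Real.sqrt (2 * omega m p))⁻¹ : ℝ) : ℂ) * c) • v⟫_ℂ
      = (((2 * omega m p)⁻¹ : ℝ) : ℂ) * (c * ⟪annCov m Φ p, v⟫_ℂ) := by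
  rw [ann, inner_smul_left, inner_smul_right, Complex.conj_ofReal, ← annCov_apply,
    ← inv_sqrt_omega_mul_self]
  ring

/-- The term `p_j / (2 ω_p)` of the generator cancels the derivative of `(2 ω_p)^{-1/2}`. -/
lemma boost_integrand (Φ Ψ : SchwartzDomain n) (j : Fin n) (p : E n) :
    ⟪ann m p Φ, ((covComp p j / (2 * omega m p) : ℝ) : ℂ) • ann m p Ψ
        - ((omega m p : ℝ) : ℂ) • partialDeriv j (fun q => ann m q Ψ) p⟫_ℂ
      = (((2 * omega m p)⁻¹ : ℝ) : ℂ) * (-(omega m p : ℂ) *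
        ⟪annCov m Φ p, ∂_{(EuclideanSpace.single j 1 : E n)} (annCov m Ψ) p⟫_ℂ) := by
  have hp : (omega m p : ℂ) ≠ 0 := Complex.ofReal_ne_zero.2 (omega_pos Fact.out p).ne'
  rw [← inner_ann_smul, partialDeriv_ann, ann, ann, ← annCov_apply, ← annCov_apply]
  congr 1
  simp only [smul_sub, smul_smul, covComp]
  match_scalars
  · field_simp
    ring
  · ring

/-- The derivatives of `(2 ω_p)^{-1/2}` cancel, since a rotation leaves `ω` invariant. -/
lemma rotation_integrand (Φ Ψ : SchwartzDomain n) (i k : Fin n) (p : E n) :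
    ⟪ann m p Φ, ((covComp p i : ℝ) : ℂ) • partialDeriv k (fun q => ann m q Ψ) p
        - ((covComp p k : ℝ) : ℂ) • partialDeriv i (fun q => ann m q Ψ) p⟫_ℂ
      = (((2 * omega m p)⁻¹ : ℝ) : ℂ) * (-(p i : ℂ) *
          ⟪annCov m Φ p, ∂_{(EuclideanSpace.single k 1 : E n)} (annCov m Ψ) p⟫_ℂ)
        + (((2 * omega m p)⁻¹ : ℝ) : ℂ) * ((p k : ℂ) *
          ⟪annCov m Φ p, ∂_{(EuclideanSpace.single i 1 : E n)} (annCov m Ψ) p⟫_ℂ) := by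
  rw [← inner_ann_smul, ← inner_ann_smul, ← inner_add_right, partialDeriv_ann, partialDeriv_ann]
  congr 1
  simp only [smul_sub, smul_smul, covComp]
  match_scalars <;> ring

theorem exists_boostGenerator (j : Fin n) :
    ∃ T : SchwartzDomain n →ₗ[ℂ] SchwartzDomain n, IsBoostGenerator m j T := by
  have hg : Function.HasTemperateGrowth fun p : E n => -(omega m p : ℂ) :=
    (hasTemperateGrowth_omega m).neg
  refine ⟨Complex.I • dGamma j hg, fun Φ Ψ => ?_⟩
  simp_rw [boost_integrand]
  refine ⟨integrable_inv_omega_mul_inner m hg _ _, ?_⟩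
  rw [LinearMap.smul_apply, map_smul, inner_smul_right, inner_toFock_dGamma]

theorem exists_rotationGenerator (i k : Fin n) :
    ∃ T : SchwartzDomain n →ₗ[ℂ] SchwartzDomain n, IsRotationGenerator m i k T := by
  have hi : Function.HasTemperateGrowth fun p : E n => -((p i : ℝ) : ℂ) :=
    (hasTemperateGrowth_coord i).neg
  have hk := hasTemperateGrowth_coord k
  refine ⟨Complex.I • (dGamma k hi + dGamma i hk), fun Φ Ψ => ?_⟩
  have hint₁ := integrable_inv_omega_mul_inner m hi (annCov m Φ)
    (∂_{(EuclideanSpace.single k 1 : E n)} (annCov m Ψ))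
  have hint₂ := integrable_inv_omega_mul_inner m hk (annCov m Φ)
    (∂_{(EuclideanSpace.single i 1 : E n)} (annCov m Ψ))
  simp_rw [rotation_integrand]
  refine ⟨hint₁.add hint₂, ?_⟩
  rw [integral_add hint₁ hint₂, LinearMap.smul_apply, map_smul, inner_smul_right,
    LinearMap.add_apply, map_add, inner_add_right, inner_toFock_dGamma, inner_toFock_dGamma]

theorem existsUnique_boostGenerator (j : Fin n) :
    ∃! T : SchwartzDomain n →ₗ[ℂ] SchwartzDomain n, IsBoostGenerator m j T :=
  existsUnique_of_exists_of_unique (exists_boostGenerator m j) fun _ _ h h' =>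
    eq_of_inner_toFock m fun Φ Ψ => (h Φ Ψ).2.trans (h' Φ Ψ).2.symm

theorem existsUnique_rotationGenerator (i k : Fin n) :
    ∃! T : SchwartzDomain n →ₗ[ℂ] SchwartzDomain n, IsRotationGenerator m i k T :=
  existsUnique_of_exists_of_unique (exists_rotationGenerator m i k) fun _ _ h h' =>
    eq_of_inner_toFock m fun Φ Ψ => (h Φ Ψ).2.trans (h' Φ Ψ).2.symm

end AnnSchwartz

/-! ### The Fourier transform to coordinate space -/

section PlaneWaves

variable {n : ℕ}

lemma contract_eq_neg_inner (p x : E n) : contract p x = -⟪p, x⟫_ℝ := by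
  simp [contract, covComp, PiLp.inner_apply, mul_comm]

lemma exp_neg_I_mul_contract (p x : E n) :
    Complex.exp (-Complex.I * (contract p x : ℝ)) = Complex.exp (⟪p, x⟫_ℝ * Complex.I) := by
  rw [contract_eq_neg_inner, Complex.ofReal_neg, neg_mul_neg, mul_comm]

/-- The normalization `(2π)^{-n/2}` of the Fourier transform to coordinate space. -/
noncomputable def planeWaveNorm (n : ℕ) : ℂ := (((2 * Real.pi) ^ (-(n : ℝ) / 2) : ℝ) : ℂ)

lemma conj_planeWaveNorm (n : ℕ) : (starRingEnd ℂ) (planeWaveNorm n) = planeWaveNorm n :=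
  Complex.conj_ofReal _

lemma planeWaveNorm_mul_self (n : ℕ) :
    planeWaveNorm n * planeWaveNorm n = (((2 * Real.pi) ^ (-(n : ℝ)) : ℝ) : ℂ) := by
  rw [planeWaveNorm, ← Complex.ofReal_mul, ← Real.rpow_add (by positivity), add_halves]

/-- The dilation `x ↦ x / (2π)`, which relates the plane waves `e^{i p·x}` to the characters
`e^{2πi p·x}` of the Fourier transform `𝓕`. -/
noncomputable def dilation (n : ℕ) : E n ≃L[ℝ] E n :=
  ContinuousLinearEquiv.smulLeft (Units.mk0 (2 * Real.pi)⁻¹ (by positivity : (2 * Real.pi)⁻¹ ≠ 0))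

lemma dilation_apply (x : E n) : dilation n x = (2 * Real.pi)⁻¹ • x := rfl

lemma two_pi_mul_inner_dilation (p x : E n) : 2 * Real.pi * ⟪p, dilation n x⟫_ℝ = ⟪p, x⟫_ℝ := by
  rw [dilation_apply, inner_smul_right, mul_inv_cancel_left₀ (by positivity)]

lemma inner_dilation_left (p x : E n) : ⟪dilation n p, x⟫_ℝ = ⟪p, dilation n x⟫_ℝ := by
  rw [dilation_apply, dilation_apply, real_inner_smul_left, real_inner_smul_right]

lemma two_pi_mul_inner_dilation_single (p : E n) (j : Fin n) :
    (2 * Real.pi : ℂ) * (⟪p, dilation n (EuclideanSpace.single j 1)⟫_ℝ : ℂ) = (p j : ℂ) := by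
  have h := two_pi_mul_inner_dilation p (EuclideanSpace.single j 1)
  rw [EuclideanSpace.inner_single_right, one_mul, conj_trivial] at h
  exact_mod_cast h

lemma planeWaveNorm_mul_self_smul_integral_comp_dilation {V : Type*} [NormedAddCommGroup V]
    [NormedSpace ℂ V] (F : E n → V) :
    (planeWaveNorm n * planeWaveNorm n) • ∫ x, F (dilation n x) = ∫ y, F y := by
  simp_rw [dilation_apply]
  rw [Measure.integral_comp_inv_smul, finrank_euclideanSpace_fin, abs_of_pos (by positivity),
    planeWaveNorm_mul_self, Complex.coe_smul, smul_smul, Real.rpow_neg (by positivity),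
    Real.rpow_natCast, inv_mul_cancel₀ (by positivity), one_smul]

end PlaneWaves

section CoordFT

variable {n : ℕ} {V : Type*} [NormedAddCommGroup V] [InnerProductSpace ℂ V]

/-- The Fourier transform `x ↦ (2π)^{-n/2} ∫ dⁿp e^{-i p_k x^k} f(p)` of a Schwartz map. -/
noncomputable def coordFT (f : 𝓢(E n, V)) : 𝓢(E n, V) :=
  planeWaveNorm n • SchwartzMap.compCLMOfContinuousLinearEquiv ℂ (dilation n) (𝓕⁻ f)

lemma coordFT_eq (f : 𝓢(E n, V)) (x : E n) :
    coordFT f x = planeWaveNorm n • (𝓕⁻ f) (dilation n x) :=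
  rfl

lemma coordFT_apply (f : 𝓢(E n, V)) (x : E n) : coordFT f x = planeWaveNorm n •
    ∫ p : E n, Complex.exp (-Complex.I * (contract p x : ℝ)) • f p := by
  rw [coordFT_eq, SchwartzMap.fourierInv_coe, Real.fourierInv_eq']
  simp_rw [two_pi_mul_inner_dilation, exp_neg_I_mul_contract]

lemma coordFT_smul (c : ℂ) (f : 𝓢(E n, V)) : coordFT (c • f) = c • coordFT f := by
  rw [coordFT, coordFT, FourierTransform.fourierInv_smul, map_smul, smul_comm]

lemma coordFT_sub (f g : 𝓢(E n, V)) : coordFT (f - g) = coordFT f - coordFT g := by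
  have hsub : 𝓕⁻ (f - g) = 𝓕⁻ f - 𝓕⁻ g :=
    map_sub (AddMonoidHom.mk' (𝓕⁻ : 𝓢(E n, V) → 𝓢(E n, V)) FourierTransform.fourierInv_add) f g
  rw [coordFT, coordFT, coordFT, hsub, map_sub, smul_sub]

/-- Multiplication of a Schwartz map by the coordinate `p^j`, as a Schwartz map. -/
noncomputable def mulCoord (j : Fin n) (f : 𝓢(E n, V)) : 𝓢(E n, V) :=
  SchwartzMap.smulLeftCLM V (fun p : E n => ((p j : ℝ) : ℂ)) f

lemma mulCoord_apply (j : Fin n) (f : 𝓢(E n, V)) (p : E n) :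
    mulCoord j f p = ((p j : ℝ) : ℂ) • f p :=
  SchwartzMap.smulLeftCLM_apply_apply (hasTemperateGrowth_coord j) f p

lemma smulLeftCLM_inner_apply (v : E n) (f : 𝓢(E n, V)) (p : E n) :
    SchwartzMap.smulLeftCLM V (fun p : E n => ⟪p, v⟫_ℝ) f p = (⟪p, v⟫_ℝ : ℂ) • f p := by
  rw [SchwartzMap.smulLeftCLM_apply_apply (by fun_prop), Complex.coe_smul]

lemma lineDerivOp_coordFT (k : Fin n) (f : 𝓢(E n, V)) :
    ∂_{(EuclideanSpace.single k 1 : E n)} (coordFT f) = coordFT (Complex.I • mulCoord k f) := by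
  rw [coordFT, coordFT, LineDeriv.lineDerivOp_smul,
    SchwartzMap.lineDerivOp_compCLMOfContinuousLinearEquiv, SchwartzMap.lineDerivOp_fourierInv_eq]
  congr 3
  ext1 p
  rw [smul_apply, smul_apply, smulLeftCLM_inner_apply, mulCoord_apply, smul_smul, smul_smul]
  congr 1
  rw [mul_right_comm, two_pi_mul_inner_dilation_single, mul_comm]

lemma coord_smul_coordFT (j : Fin n) (f : 𝓢(E n, V)) (x : E n) :
    ((x j : ℝ) : ℂ) • coordFT f x
      = coordFT (Complex.I • ∂_{(EuclideanSpace.single j 1 : E n)} f) x := by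
  rw [coordFT_smul, smul_apply, coordFT_eq, coordFT_eq, SchwartzMap.fourierInv_lineDerivOp_eq,
    smul_apply, smulLeftCLM_inner_apply, inner_dilation_left, smul_smul, smul_smul, smul_smul,
    smul_smul]
  congr 1
  rw [← two_pi_mul_inner_dilation_single x j]
  linear_combination (2 * Real.pi * ⟪x, dilation n (EuclideanSpace.single j 1)⟫_ℝ * planeWaveNorm n)
    * Complex.I_mul_I

variable [CompleteSpace V]

/-- The square of the Fourier transform is the reflection. -/
lemma coordFT_coordFT (f : 𝓢(E n, V)) (x : E n) : coordFT (coordFT f) x = f (-x) := by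
  have hinv : 𝓕 (𝓕⁻ f) = f := FourierTransform.fourier_fourierInv_eq f
  calc coordFT (coordFT f) x
      = (planeWaveNorm n * planeWaveNorm n) • ∫ p : E n, Complex.exp
          ((2 * Real.pi * ⟪dilation n p, x⟫_ℝ : ℝ) * Complex.I) • (𝓕⁻ f) (dilation n p) := by
        simp_rw [coordFT_apply _ x, coordFT_eq, smul_comm _ (planeWaveNorm n)]
        rw [integral_smul, smul_smul]
        simp_rw [exp_neg_I_mul_contract, real_inner_comm x, two_pi_mul_inner_dilation]
    _ = ∫ v : E n, Complex.exp ((2 * Real.pi * ⟪v, x⟫_ℝ : ℝ) * Complex.I) • (𝓕⁻ f) v :=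
        planeWaveNorm_mul_self_smul_integral_comp_dilation fun v : E n =>
          Complex.exp ((2 * Real.pi * ⟪v, x⟫_ℝ : ℝ) * Complex.I) • (𝓕⁻ f) v
    _ = 𝓕 (𝓕⁻ f) (-x) := by
        rw [← Real.fourierInv_eq', Real.fourierInv_eq_fourier_neg, SchwartzMap.fourier_coe]
    _ = f (-x) := by rw [hinv]

lemma fourier_translate_fourierInv (f : 𝓢(E n, V)) (u p : E n) :
    𝓕 (SchwartzMap.compSubConstCLM ℂ (-dilation n u) (𝓕⁻ f)) p
      = Complex.exp (⟪p, u⟫_ℝ * Complex.I) • f p := by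
  have hinv : 𝓕 (𝓕⁻ f) = f := FourierTransform.fourier_fourierInv_eq f
  have hshift : (SchwartzMap.compSubConstCLM ℂ (-dilation n u) (𝓕⁻ f) : E n → V)
      = (𝓕⁻ f : 𝓢(E n, V)) ∘ fun v => v + dilation n u := by
    funext v
    simp
  rw [SchwartzMap.fourier_coe, hshift]
  calc 𝓕 ((𝓕⁻ f : 𝓢(E n, V)) ∘ fun v => v + dilation n u) p
      = Real.fourierChar ⟪dilation n u, p⟫_ℝ • 𝓕 (𝓕⁻ f : 𝓢(E n, V)) p :=
        congrFun (VectorFourier.fourierIntegral_comp_add_right Real.fourierChar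
          (volume : Measure (E n)) (innerₗ (E n)) (𝓕⁻ f : 𝓢(E n, V)) (dilation n u)) p
    _ = Complex.exp (⟪p, u⟫_ℝ * Complex.I) • f p := by
        rw [hinv, Circle.smul_def, Real.fourierChar_apply, real_inner_comm,
          two_pi_mul_inner_dilation]

/-- Plancherel's identity with a translation. -/
lemma integral_inner_coordFT_translate (f g : 𝓢(E n, V)) (u : E n) :
    ∫ x, ⟪coordFT f x, coordFT g (x + u)⟫_ℂ
      = ∫ p, Complex.exp (⟪p, u⟫_ℝ * Complex.I) * ⟪f p, g p⟫_ℂ := by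
  set G := SchwartzMap.compSubConstCLM ℂ (-dilation n u) (𝓕⁻ g)
  have hG (x : E n) : G (dilation n x) = (𝓕⁻ g) (dilation n (x + u)) := by
    change (𝓕⁻ g) (dilation n x - -dilation n u) = _
    rw [sub_neg_eq_add, map_add (dilation n)]
  have hinv : 𝓕 (𝓕⁻ f) = f := FourierTransform.fourier_fourierInv_eq f
  calc ∫ x, ⟪coordFT f x, coordFT g (x + u)⟫_ℂ
      = (planeWaveNorm n * planeWaveNorm n) •
          ∫ x, ⟪(𝓕⁻ f : 𝓢(E n, V)) (dilation n x), G (dilation n x)⟫_ℂ := by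
        rw [← integral_smul]
        refine integral_congr_ae (Eventually.of_forall fun x => ?_)
        beta_reduce
        rw [coordFT_eq, coordFT_eq, inner_smul_left, inner_smul_right, conj_planeWaveNorm, hG,
          smul_eq_mul, mul_assoc]
    _ = ∫ y, ⟪(𝓕⁻ f : 𝓢(E n, V)) y, G y⟫_ℂ :=
        planeWaveNorm_mul_self_smul_integral_comp_dilation fun y => ⟪(𝓕⁻ f : 𝓢(E n, V)) y, G y⟫_ℂ
    _ = ∫ p, ⟪𝓕 (𝓕⁻ f) p, 𝓕 G p⟫_ℂ :=
        (SchwartzMap.integral_sesq_fourier_fourier (𝓕⁻ f) G (innerSL ℂ)).symm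
    _ = ∫ p, Complex.exp (⟪p, u⟫_ℝ * Complex.I) * ⟪f p, g p⟫_ℂ := by
        simp_rw [hinv, G, fourier_translate_fourierInv, inner_smul_right]

lemma integral_inner_coordFT (f g : 𝓢(E n, V)) :
    ∫ x, ⟪coordFT f x, coordFT g x⟫_ℂ = ∫ p, ⟪f p, g p⟫_ℂ := by
  simpa using integral_inner_coordFT_translate f g 0

end CoordFT

/-! ### Multiplication by the energy -/

section MulOmega

variable {n : ℕ} {V : Type*} [NormedAddCommGroup V] [InnerProductSpace ℂ V]

lemma partialDeriv_schwartz (j : Fin n) (f : 𝓢(E n, V)) (p : E n) :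
    partialDeriv j f p = ∂_{(EuclideanSpace.single j 1 : E n)} f p :=
  rfl

lemma lineDerivOp_smulLeftCLM {a : E n → ℝ}
    (ha : Function.HasTemperateGrowth fun p => (a p : ℂ)) (f : 𝓢(E n, V)) {a' : E n →L[ℝ] ℝ}
    {p : E n} (h : HasFDerivAt a a' p) (v : E n) :
    ∂_{v} (SchwartzMap.smulLeftCLM V (fun p => (a p : ℂ)) f) p
      = (a p : ℂ) • ∂_{v} f p + (a' v : ℂ) • f p := by
  have hsmul : (SchwartzMap.smulLeftCLM V (fun p => (a p : ℂ)) f : E n → V)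
      = fun q => a q • f q := by
    funext q
    rw [SchwartzMap.smulLeftCLM_apply_apply ha, Complex.coe_smul]
  have hderiv : HasFDerivAt (fun q => a q • f q) _ p := h.smul (f.hasFDerivAt p)
  rw [SchwartzMap.lineDerivOp_apply_eq_fderiv, SchwartzMap.lineDerivOp_apply_eq_fderiv, hsmul,
    hderiv.fderiv]
  simp only [add_apply, smul_apply, ContinuousLinearMap.smulRight_apply, Complex.coe_smul]

lemma integral_inner_lineDerivOp_left (f g : 𝓢(E n, V)) (v : E n) :
    ∫ p, ⟪∂_{v} f p, g p⟫_ℂ = -∫ p, ⟪f p, ∂_{v} g p⟫_ℂ :=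
  neg_eq_iff_eq_neg.1 (SchwartzMap.integral_bilinear_lineDerivOp_right_eq_neg_left (μ := volume) f g
    (isBoundedBilinearMap_inner (𝕜 := ℂ) (E := V)).toContinuousLinearMap v).symm

variable (m : ℝ) [Fact (0 < m)]

/-- Multiplication of a Schwartz map by the energy `ω_p`, as a Schwartz map. -/
noncomputable def mulOmega (f : 𝓢(E n, V)) : 𝓢(E n, V) :=
  SchwartzMap.smulLeftCLM V (fun p : E n => (omega m p : ℂ)) f

lemma mulOmega_apply (f : 𝓢(E n, V)) (p : E n) : mulOmega m f p = (omega m p : ℂ) • f p :=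
  SchwartzMap.smulLeftCLM_apply_apply (hasTemperateGrowth_omega m) f p

lemma lineDerivOp_mulOmega (j : Fin n) (f : 𝓢(E n, V)) (p : E n) :
    ∂_{(EuclideanSpace.single j 1 : E n)} (mulOmega m f) p
      = (omega m p : ℂ) • ∂_{(EuclideanSpace.single j 1 : E n)} f p
        + ((p j / omega m p : ℝ) : ℂ) • f p := by
  rw [mulOmega, lineDerivOp_smulLeftCLM (hasTemperateGrowth_omega m) f (hasFDerivAt_omega m p),
    smul_apply, innerSL_apply_apply, EuclideanSpace.inner_single_right, one_mul, conj_trivial,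
    smul_eq_mul, inv_mul_eq_div]

lemma integrable_omega_mul_schwartz (f : 𝓢(E n, ℂ)) :
    Integrable fun p => (omega m p : ℂ) * f p := by
  simp_rw [← smul_eq_mul, ← mulOmega_apply]
  exact (mulOmega m f).integrable

lemma integrable_omega_mul_inner (f g : 𝓢(E n, V)) :
    Integrable fun p => (omega m p : ℂ) * ⟪f p, g p⟫_ℂ := by
  simp_rw [← inner_smul_right, ← mulOmega_apply]
  exact integrable_inner_schwartz f (mulOmega m g)

lemma integral_omega_mul_inner_lineDerivOp_left (f g : 𝓢(E n, V)) (v : E n) :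
    ∫ p, (omega m p : ℂ) * ⟪∂_{v} f p, g p⟫_ℂ = -∫ p, ⟪f p, ∂_{v} (mulOmega m g) p⟫_ℂ := by
  simp_rw [← inner_smul_right, ← mulOmega_apply]
  exact integral_inner_lineDerivOp_left f (mulOmega m g) v

/-- Half of the derivative of `ω_p` is the term `p^j / (2 ω_p)`, so the boost generator is the
symmetrized product of `ω_p` and `i ∂/∂p^j`. -/
lemma integral_inner_boost (j : Fin n) (f g : 𝓢(E n, V)) :
    Complex.I * ∫ p, ⟪f p, ((covComp p j / (2 * omega m p) : ℝ) : ℂ) • g p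
        - ((omega m p : ℝ) : ℂ) • partialDeriv j g p⟫_ℂ
      = -(1 / 2 : ℂ) *
        ((∫ p, (omega m p : ℂ) * ⟪(Complex.I • ∂_{(EuclideanSpace.single j 1 : E n)} f) p, g p⟫_ℂ)
        + ∫ p, (omega m p : ℂ) *
          ⟪f p, (Complex.I • ∂_{(EuclideanSpace.single j 1 : E n)} g) p⟫_ℂ) := by
  have hpt (p : E n) : ⟪f p, ((covComp p j / (2 * omega m p) : ℝ) : ℂ) • g p
        - ((omega m p : ℝ) : ℂ) • partialDeriv j g p⟫_ℂ
      = -(1 / 2 : ℂ) * (⟪f p, ∂_{(EuclideanSpace.single j 1 : E n)} (mulOmega m g) p⟫_ℂ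
        + (omega m p : ℂ) * ⟪f p, ∂_{(EuclideanSpace.single j 1 : E n)} g p⟫_ℂ) := by
    have hp : (omega m p : ℂ) ≠ 0 := Complex.ofReal_ne_zero.2 (omega_pos Fact.out p).ne'
    rw [lineDerivOp_mulOmega, partialDeriv_schwartz, inner_add_right, inner_sub_right]
    simp only [inner_smul_right, covComp]
    push_cast
    field_simp
    ring
  simp_rw [hpt, smul_apply, inner_smul_left, inner_smul_right, Complex.conj_I,
    mul_left_comm _ (-Complex.I), mul_left_comm _ Complex.I, integral_const_mul]
  rw [integral_add (integrable_inner_schwartz f _) (integrable_omega_mul_inner m f _),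
    integral_omega_mul_inner_lineDerivOp_left]
  ring

end MulOmega

/-! ### The kernel as the Fourier transform of the energy -/

section Kernel

variable {n : ℕ}

lemma omega_neg (m : ℝ) (p : E n) : omega m (-p) = omega m p := by
  rw [omega, omega, norm_neg]

lemma omegaTilde_neg (m : ℝ) (x : E n) : omegaTilde m (-x) = omegaTilde m x := by
  rw [omegaTilde, omegaTilde, norm_neg]

/-- Fourier inversion; the square of `coordFT` being the reflection, `p ↦ coordFT φ (-p)` is the
inverse transform of `φ`. -/
lemma planeWaveIntegral_coordFT_neg (φ : 𝓢(E n, ℂ)) (x : E n) :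
    planeWaveIntegral (fun p => planeWaveNorm n * coordFT φ (-p)) x = φ x := by
  rw [← neg_neg x, ← coordFT_coordFT φ, ← coordFT_coordFT (coordFT (coordFT φ)), coordFT_apply]
  simp_rw [coordFT_coordFT (coordFT φ), planeWaveIntegral, exp_neg_I_mul_contract, neg_neg,
    mul_left_comm _ (planeWaveNorm n), integral_const_mul, smul_eq_mul]

lemma planeWaveNorm_mul_integral_exp_mul (φ : 𝓢(E n, ℂ)) (p : E n) :
    planeWaveNorm n * ∫ x : E n, Complex.exp (-Complex.I * (contract p x : ℝ)) * φ x
      = coordFT φ p := by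
  simp_rw [coordFT_apply, contract_eq_neg_inner, real_inner_comm p, smul_eq_mul]

lemma integrableOn_omegaTilde_mul_schwartz {m : ℝ} (hm : 0 < m) (φ : 𝓢(E n, ℂ)) {ε : ℝ}
    (hε : 0 < ε) : IntegrableOn (fun x : E n => (omegaTilde m x : ℂ) * φ x) {x | ε < ‖x‖} := by
  simp_rw [← planeWaveIntegral_coordFT_neg φ]
  exact integrableOn_omegaTilde_mul_planeWaveIntegral hm
    ((coordFT φ).integrable.comp_neg.const_mul _) hε

variable (m : ℝ) [Fact (0 < m)]

lemma integrable_omega_mul_integral_exp_mul (φ : 𝓢(E n, ℂ)) :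
    Integrable fun p : E n => (omega m p : ℂ) *
      ∫ x : E n, Complex.exp (-Complex.I * (contract p x : ℝ)) * φ x := by
  have hN : planeWaveNorm n ≠ 0 :=
    Complex.ofReal_ne_zero.2 (Real.rpow_pos_of_pos (by positivity) _).ne'
  rw [← integrable_const_mul_iff hN.isUnit]
  simp_rw [mul_left_comm (planeWaveNorm n), planeWaveNorm_mul_integral_exp_mul]
  exact integrable_omega_mul_schwartz m (coordFT φ)

theorem hasFinitePart_omegaTilde_mul_schwartz [Nontrivial (E n)] (φ : 𝓢(E n, ℂ)) :
    HasFinitePart (fun ε : ℝ => ∫ x in {x : E n | ε < ‖x‖}, (omegaTilde m x : ℂ) * φ x)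
      ((((2 * Real.pi) ^ (-(n : ℝ)) : ℝ) : ℂ) * ∫ p : E n, (omega m p : ℂ) *
        ∫ x : E n, Complex.exp (-Complex.I * (contract p x : ℝ)) * φ x) := by
  have hω : Integrable fun p : E n => (omega m p : ℂ) * (planeWaveNorm n * coordFT φ (-p)) := by
    refine ((integrable_omega_mul_schwartz m (coordFT φ)).comp_neg.const_mul
      (planeWaveNorm n)).congr (Eventually.of_forall fun p => ?_)
    beta_reduce
    rw [omega_neg, mul_left_comm]
  have h := hasFinitePart_omegaTilde_mul_planeWaveIntegral Fact.out
    ((coordFT φ).integrable.comp_neg.const_mul (planeWaveNorm n)) hω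
  simp_rw [planeWaveIntegral_coordFT_neg] at h
  convert h using 1
  calc _ = planeWaveNorm n * ∫ p : E n, (omega m p : ℂ) * coordFT φ p := by
        simp_rw [← planeWaveNorm_mul_self, ← planeWaveNorm_mul_integral_exp_mul,
          mul_left_comm _ (planeWaveNorm n), integral_const_mul, mul_assoc]
    _ = planeWaveNorm n * ∫ p : E n, (omega m (-p) : ℂ) * coordFT φ (-p) := by
        rw [integral_neg_eq_self fun p : E n => (omega m p : ℂ) * coordFT φ p]
    _ = _ := by
        simp_rw [omega_neg, mul_left_comm _ (planeWaveNorm n), integral_const_mul]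

end Kernel

/-! ### The generators in coordinate space -/

section FinitePart

variable {J K : ℝ → ℂ} {a b : ℂ}

lemma HasFinitePart.add (hJ : HasFinitePart J a) (hK : HasFinitePart K b) :
    HasFinitePart (fun ε => J ε + K ε) (a + b) := by
  obtain ⟨C, hC⟩ := hJ
  obtain ⟨D, hD⟩ := hK
  exact ⟨C + D, (hC.add hD).congr fun ε => by ring⟩

lemma HasFinitePart.const_mul (c : ℂ) (hJ : HasFinitePart J a) :
    HasFinitePart (fun ε => c * J ε) (c * a) := by
  obtain ⟨C, hC⟩ := hJ
  exact ⟨c * C, (hC.const_mul c).congr fun ε => by ring⟩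

lemma HasFinitePart.congr (hJ : HasFinitePart J a) (h : ∀ ε, 0 < ε → J ε = K ε) :
    HasFinitePart K a := by
  obtain ⟨C, hC⟩ := hJ
  refine ⟨C, hC.congr' ?_⟩
  filter_upwards [self_mem_nhdsWithin] with ε hε
  rw [h ε hε]

end FinitePart

section Shear

variable {V F : Type*} [NormedAddCommGroup V] [NormedAddCommGroup F]

lemma shear_preimage_lt_norm_sub (ε : ℝ) :
    (fun z : V × V => (z.1, z.1 + z.2)) ⁻¹' {z | ε < ‖z.1 - z.2‖} = Set.univ ×ˢ {u | ε < ‖u‖} := by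
  ext z
  simp

variable [SecondCountableTopology V] [MeasurableSpace V] [BorelSpace V] {μ ν : Measure V}
  [SFinite μ] [SFinite ν] [ν.IsAddLeftInvariant]

lemma integrableOn_lt_norm_sub_iff {h : V × V → F} {ε : ℝ} :
    IntegrableOn h {z | ε < ‖z.1 - z.2‖} (μ.prod ν) ↔
      Integrable (fun z : V × V => h (z.1, z.1 + z.2)) (μ.prod (ν.restrict {u | ε < ‖u‖})) := by
  rw [← (measurePreserving_prod_add μ ν).integrableOn_comp_preimage
    (MeasurableEquiv.shearAddRight V).measurableEmbedding, shear_preimage_lt_norm_sub,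
    IntegrableOn, ← Measure.prod_restrict, Measure.restrict_univ, Function.comp_def]

lemma setIntegral_lt_norm_sub [NormedSpace ℝ F] (h : V × V → F) (ε : ℝ) :
    ∫ z in {z | ε < ‖z.1 - z.2‖}, h z ∂(μ.prod ν)
      = ∫ z, h (z.1, z.1 + z.2) ∂(μ.prod (ν.restrict {u | ε < ‖u‖})) := by
  rw [← (measurePreserving_prod_add μ ν).setIntegral_preimage_emb
    (MeasurableEquiv.shearAddRight V).measurableEmbedding, shear_preimage_lt_norm_sub,
    ← Measure.prod_restrict, Measure.restrict_univ]

end Shear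

section Pairing

variable {n : ℕ} {V : Type*} [NormedAddCommGroup V] [InnerProductSpace ℂ V]

lemma integrableOn_omegaTilde {m : ℝ} (hm : 0 < m) {ε : ℝ} (hε : 0 < ε) :
    IntegrableOn (omegaTilde m : E n → ℝ) {x | ε < ‖x‖} :=
  (integrableOn_subordKernel m hε).neg.congr_fun (fun _ hx =>
    (omegaTilde_eq_neg_subordKernel hm (norm_pos_iff.1 (hε.trans hx))).symm)
    (measurableSet_lt_norm ε)

lemma integrable_omegaTilde_mul_inner_translate {m : ℝ} (hm : 0 < m) (f g : 𝓢(E n, V)) {ε : ℝ}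
    (hε : 0 < ε) :
    Integrable (fun z : E n × E n => (omegaTilde m z.2 : ℂ) * ⟪f z.1, g (z.1 + z.2)⟫_ℂ)
      (volume.prod (volume.restrict {u | ε < ‖u‖})) := by
  have hω : IntegrableOn (omegaTilde m : E n → ℝ) {x | ε < ‖x‖} := integrableOn_omegaTilde hm hε
  obtain ⟨C, -, hC⟩ := g.decay 0 0
  have hC (x : E n) : ‖g x‖ ≤ C := by simpa using hC x
  have hcont : Continuous fun z : E n × E n => ⟪f z.1, g (z.1 + z.2)⟫_ℂ := by fun_prop
  refine (f.integrable.norm.mul_prod (hω.norm.mul_const C)).mono'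
    ((Complex.continuous_ofReal.comp_aestronglyMeasurable hω.aestronglyMeasurable.comp_snd).mul
      hcont.aestronglyMeasurable) (Eventually.of_forall fun z => ?_)
  calc ‖(omegaTilde m z.2 : ℂ) * ⟪f z.1, g (z.1 + z.2)⟫_ℂ‖
      = ‖omegaTilde m z.2‖ * ‖⟪f z.1, g (z.1 + z.2)⟫_ℂ‖ := by rw [norm_mul, Complex.norm_real]
    _ ≤ ‖omegaTilde m z.2‖ * (‖f z.1‖ * C) := by
        gcongr
        exact (norm_inner_le_norm _ _).trans (by gcongr; exact hC _)
    _ = ‖f z.1‖ * (‖omegaTilde m z.2‖ * C) := mul_left_comm _ _ _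

lemma integrableOn_omegaTilde_sub_mul_inner {m : ℝ} (hm : 0 < m) (f g : 𝓢(E n, V)) {ε : ℝ}
    (hε : 0 < ε) : IntegrableOn (fun z : E n × E n =>
      (omegaTilde m (z.1 - z.2) : ℂ) * ⟪f z.1, g z.2⟫_ℂ) {z | ε < ‖z.1 - z.2‖} := by
  rw [Measure.volume_eq_prod, integrableOn_lt_norm_sub_iff]
  simp_rw [sub_add_cancel_left, omegaTilde_neg]
  exact integrable_omegaTilde_mul_inner_translate hm f g hε

variable [CompleteSpace V] (m : ℝ) [Fact (0 < m)]

/-- In coordinate space the multiplication by the energy is the integral operator with kernel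
`ω̃(x - y)`: by Plancherel, the correlation of the two Fourier transforms is the plane wave integral
of `⟪f, g⟫`. -/
theorem hasFinitePart_omegaTilde_sub_mul_inner_coordFT [Nontrivial (E n)] (f g : 𝓢(E n, V)) :
    HasFinitePart (fun ε : ℝ => ∫ z in {z : E n × E n | ε < ‖z.1 - z.2‖},
      (omegaTilde m (z.1 - z.2) : ℂ) * ⟪coordFT f z.1, coordFT g z.2⟫_ℂ)
      (∫ p, (omega m p : ℂ) * ⟪f p, g p⟫_ℂ) := by
  refine (hasFinitePart_omegaTilde_mul_planeWaveIntegral Fact.out (integrable_inner_schwartz f g)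
    (integrable_omega_mul_inner m f g)).congr fun ε hε => ?_
  rw [Measure.volume_eq_prod, setIntegral_lt_norm_sub]
  simp_rw [sub_add_cancel_left, omegaTilde_neg]
  rw [integral_prod_symm _ (integrable_omegaTilde_mul_inner_translate Fact.out _ _ hε)]
  simp_rw [integral_const_mul, integral_inner_coordFT_translate, planeWaveIntegral]

end Pairing

section AngularMomentum

variable {n : ℕ} {V : Type*} [NormedAddCommGroup V] [InnerProductSpace ℂ V]

/-- The angular momentum operator `p_i ∂/∂p^k - p_k ∂/∂p^i` on Schwartz maps, with the derivatives
to the left of the coordinates. -/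
noncomputable def angularMomentum (i k : Fin n) (f : 𝓢(E n, V)) : 𝓢(E n, V) :=
  ∂_{(EuclideanSpace.single i 1 : E n)} (mulCoord k f)
    - ∂_{(EuclideanSpace.single k 1 : E n)} (mulCoord i f)

lemma lineDerivOp_mulCoord (i k : Fin n) (f : 𝓢(E n, V)) (p : E n) :
    ∂_{(EuclideanSpace.single i 1 : E n)} (mulCoord k f) p
      = ((p k : ℝ) : ℂ) • partialDeriv i f p
        + ((EuclideanSpace.single i (1 : ℝ) k : ℝ) : ℂ) • f p :=
  lineDerivOp_smulLeftCLM (hasTemperateGrowth_coord k) f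
    (EuclideanSpace.proj k : E n →L[ℝ] ℝ).hasFDerivAt (EuclideanSpace.single i 1)

/-- The two commutators of a derivative with a coordinate cancel. -/
lemma angularMomentum_apply (i k : Fin n) (f : 𝓢(E n, V)) (p : E n) :
    angularMomentum i k f p = ((covComp p i : ℝ) : ℂ) • partialDeriv k f p
      - ((covComp p k : ℝ) : ℂ) • partialDeriv i f p := by
  rw [angularMomentum, sub_apply, lineDerivOp_mulCoord, lineDerivOp_mulCoord, covComp, covComp,
    PiLp.single_apply, PiLp.single_apply]
  simp only [Complex.ofReal_neg, neg_smul, @eq_comm _ i k]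
  abel

lemma coordFT_lineDerivOp_mulCoord (i k : Fin n) (f : 𝓢(E n, V)) (x : E n) :
    coordFT (∂_{(EuclideanSpace.single i 1 : E n)} (mulCoord k f)) x
      = ((covComp x i : ℝ) : ℂ) • partialDeriv k (coordFT f) x := by
  rw [partialDeriv_schwartz, lineDerivOp_coordFT, covComp, Complex.ofReal_neg, neg_smul,
    coord_smul_coordFT, LineDeriv.lineDerivOp_smul, smul_smul, Complex.I_mul_I, coordFT_smul,
    smul_apply, neg_one_smul, neg_neg]

lemma coordFT_angularMomentum (i k : Fin n) (f : 𝓢(E n, V)) :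
    coordFT (angularMomentum i k f) = angularMomentum i k (coordFT f) := by
  ext1 x
  rw [angularMomentum_apply, angularMomentum, coordFT_sub, sub_apply,
    coordFT_lineDerivOp_mulCoord, coordFT_lineDerivOp_mulCoord]

end AngularMomentum

section Generators

variable {n : ℕ} (m : ℝ) [Fact (0 < m)]

lemma annTilde_eq_coordFT (Ψ : SchwartzDomain n) (x : E n) :
    annTilde m x Ψ = coordFT (annSchwartz m Ψ) x := by
  simp_rw [coordFT_apply, annSchwartz_apply, annTilde, planeWaveNorm]

lemma integrable_ann (Ψ : SchwartzDomain n) : Integrable fun p : E n => ann m p Ψ := by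
  rw [← coe_annSchwartz]
  exact (annSchwartz m Ψ).integrable

lemma differentiable_ann (Ψ : SchwartzDomain n) : Differentiable ℝ fun p : E n => ann m p Ψ := by
  rw [← coe_annSchwartz]
  exact (annSchwartz m Ψ).differentiable

lemma differentiable_annTilde (Ψ : SchwartzDomain n) :
    Differentiable ℝ fun x : E n => annTilde m x Ψ := by
  simp_rw [annTilde_eq_coordFT]
  exact (coordFT (annSchwartz m Ψ)).differentiable

variable {m} {M : SchwartzDomain n →ₗ[ℂ] SchwartzDomain n}

lemma angularMomentum_coordFT_annSchwartz (i k : Fin n) (Ψ : SchwartzDomain n) (x : E n) :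
    angularMomentum i k (coordFT (annSchwartz m Ψ)) x
      = ((covComp x i : ℝ) : ℂ) • partialDeriv k (fun y => annTilde m y Ψ) x
        - ((covComp x k : ℝ) : ℂ) • partialDeriv i (fun y => annTilde m y Ψ) x := by
  simp_rw [angularMomentum_apply, annTilde_eq_coordFT]

lemma integrable_inner_annTilde_rotation (i k : Fin n) (Φ Ψ : SchwartzDomain n) :
    Integrable fun x : E n => ⟪annTilde m x Φ,
      ((covComp x i : ℝ) : ℂ) • partialDeriv k (fun y => annTilde m y Ψ) x
        - ((covComp x k : ℝ) : ℂ) • partialDeriv i (fun y => annTilde m y Ψ) x⟫_ℂ := by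
  simp_rw [← angularMomentum_coordFT_annSchwartz, annTilde_eq_coordFT]
  exact integrable_inner_schwartz _ _

theorem IsRotationGenerator.inner_eq_integral_annTilde {i k : Fin n}
    (hM : IsRotationGenerator m i k M) (Φ Ψ : SchwartzDomain n) :
    ⟪toFock m Φ, toFock m (M Ψ)⟫_ℂ = Complex.I * ∫ x : E n, ⟪annTilde m x Φ,
      ((covComp x i : ℝ) : ℂ) • partialDeriv k (fun y => annTilde m y Ψ) x
        - ((covComp x k : ℝ) : ℂ) • partialDeriv i (fun y => annTilde m y Ψ) x⟫_ℂ := by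
  rw [(hM Φ Ψ).2, ← coe_annSchwartz]
  simp_rw [← angularMomentum_coordFT_annSchwartz, annTilde_eq_coordFT, ← coordFT_angularMomentum,
    integral_inner_coordFT, angularMomentum_apply, annSchwartz_apply]

/-- On the Fourier transform side the coordinates `x^j` and `y^j` are the derivatives `i ∂/∂p^j` on
either side of the inner product. -/
lemma boost_kernel_mul_inner_annTilde (j : Fin n) (Φ Ψ : SchwartzDomain n) (x y : E n) :
    ((covComp (x + y) j * omegaTilde m (x - y) : ℝ) : ℂ) * ⟪annTilde m x Φ, annTilde m y Ψ⟫_ℂ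
      = -((omegaTilde m (x - y) : ℂ) * ⟪coordFT
            (Complex.I • ∂_{(EuclideanSpace.single j 1 : E n)} (annSchwartz m Φ)) x,
            coordFT (annSchwartz m Ψ) y⟫_ℂ
          + (omegaTilde m (x - y) : ℂ) * ⟪coordFT (annSchwartz m Φ) x, coordFT
            (Complex.I • ∂_{(EuclideanSpace.single j 1 : E n)} (annSchwartz m Ψ)) y⟫_ℂ) := by
  rw [← coord_smul_coordFT, ← coord_smul_coordFT, inner_smul_left, inner_smul_right,
    Complex.conj_ofReal, annTilde_eq_coordFT, annTilde_eq_coordFT, covComp, PiLp.add_apply]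
  push_cast
  ring

theorem integrableOn_boost_kernel_mul_inner_annTilde (j : Fin n) (Φ Ψ : SchwartzDomain n) {ε : ℝ}
    (hε : 0 < ε) : IntegrableOn (fun z : E n × E n =>
      ((covComp (z.1 + z.2) j * omegaTilde m (z.1 - z.2) : ℝ) : ℂ) *
        ⟪annTilde m z.1 Φ, annTilde m z.2 Ψ⟫_ℂ) {z | ε < ‖z.1 - z.2‖} := by
  simp_rw [boost_kernel_mul_inner_annTilde]
  exact ((integrableOn_omegaTilde_sub_mul_inner Fact.out _ _ hε).add
    (integrableOn_omegaTilde_sub_mul_inner Fact.out _ _ hε)).neg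

theorem IsBoostGenerator.hasFinitePart_inner [Nontrivial (E n)] {j : Fin n}
    (hM : IsBoostGenerator m j M) (Φ Ψ : SchwartzDomain n) :
    HasFinitePart (fun ε : ℝ => (1 / 2 : ℂ) *
      ∫ z in {z : E n × E n | ε < ‖z.1 - z.2‖},
        ((covComp (z.1 + z.2) j * omegaTilde m (z.1 - z.2) : ℝ) : ℂ) *
          ⟪annTilde m z.1 Φ, annTilde m z.2 Ψ⟫_ℂ)
      ⟪toFock m Φ, toFock m (M Ψ)⟫_ℂ := by
  rw [(hM Φ Ψ).2, ← coe_annSchwartz]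
  simp_rw [← annSchwartz_apply, boost_kernel_mul_inner_annTilde]
  rw [integral_inner_boost]
  refine (((hasFinitePart_omegaTilde_sub_mul_inner_coordFT m _ _).add
    (hasFinitePart_omegaTilde_sub_mul_inner_coordFT m _ _)).const_mul _).congr fun ε hε => ?_
  rw [integral_neg, integral_add (integrableOn_omegaTilde_sub_mul_inner Fact.out _ _ hε)
    (integrableOn_omegaTilde_sub_mul_inner Fact.out _ _ hε)]
  ring

end Generators

end ScalarField

theorem mainTheorem1 (n : ℕ) (hn : 1 ≤ n) (m : ℝ) [Fact (0 < m)] :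
    -- the ladder operators are well defined and differentiable on Schwartz states
    (∀ Ψ : SchwartzDomain n,
      Integrable (fun p : E n => ann m p Ψ) ∧
      Differentiable ℝ (fun p : E n => ann m p Ψ) ∧
      Differentiable ℝ (fun x : E n => annTilde m x Ψ)) ∧
    -- the formulas in momentum space define operators on the domain of Schwartz states
    (∀ j : Fin n, ∃! T : SchwartzDomain n →ₗ[ℂ] SchwartzDomain n, IsBoostGenerator m j T) ∧
    (∀ i k : Fin n, ∃! T : SchwartzDomain n →ₗ[ℂ] SchwartzDomain n,
      IsRotationGenerator m i k T) ∧
    -- the kernel is the Fourier transform `(2π)^{-n} ∫ dⁿp ω_p e^{-i p_k x^k}` of the energy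
    (∀ φ : 𝓢(E n, ℂ),
      (∀ ε : ℝ, 0 < ε →
        IntegrableOn (fun x : E n => (omegaTilde m x : ℂ) * φ x) {x | ε < ‖x‖}) ∧
      Integrable (fun p : E n => (omega m p : ℂ) *
        ∫ x : E n, Complex.exp (-Complex.I * (contract p x : ℝ)) * φ x) ∧
      HasFinitePart (fun ε : ℝ => ∫ x in {x : E n | ε < ‖x‖}, (omegaTilde m x : ℂ) * φ x)
        ((((2 * Real.pi) ^ (-(n : ℝ)) : ℝ) : ℂ) * ∫ p : E n, (omega m p : ℂ) *
          ∫ x : E n, Complex.exp (-Complex.I * (contract p x : ℝ)) * φ x)) ∧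
    -- `M_{j0} = ½ ∬ dⁿx dⁿy (x + y)_j ω̃(x - y) ã*(x) ã(y)`
    (∀ (j : Fin n) (M : SchwartzDomain n →ₗ[ℂ] SchwartzDomain n), IsBoostGenerator m j M →
      ∀ Φ Ψ : SchwartzDomain n,
        (∀ ε : ℝ, 0 < ε →
          IntegrableOn (fun z : E n × E n =>
            ((covComp (z.1 + z.2) j * omegaTilde m (z.1 - z.2) : ℝ) : ℂ) *
              ⟪annTilde m z.1 Φ, annTilde m z.2 Ψ⟫_ℂ) {z | ε < ‖z.1 - z.2‖}) ∧
        HasFinitePart (fun ε : ℝ => (1 / 2 : ℂ) *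
          ∫ z in {z : E n × E n | ε < ‖z.1 - z.2‖},
            ((covComp (z.1 + z.2) j * omegaTilde m (z.1 - z.2) : ℝ) : ℂ) *
              ⟪annTilde m z.1 Φ, annTilde m z.2 Ψ⟫_ℂ)
          ⟪toFock m Φ, toFock m (M Ψ)⟫_ℂ) ∧
    -- `M_{ik} = i ∫ dⁿx ã*(x) (x_i ∂/∂x^k - x_k ∂/∂x^i) ã(x)`
    (∀ (i k : Fin n) (M : SchwartzDomain n →ₗ[ℂ] SchwartzDomain n),
      IsRotationGenerator m i k M →
      ∀ Φ Ψ : SchwartzDomain n,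
        Integrable (fun x : E n => ⟪annTilde m x Φ,
          ((covComp x i : ℝ) : ℂ) • partialDeriv k (fun y => annTilde m y Ψ) x
            - ((covComp x k : ℝ) : ℂ) • partialDeriv i (fun y => annTilde m y Ψ) x⟫_ℂ) ∧
        ⟪toFock m Φ, toFock m (M Ψ)⟫_ℂ = Complex.I * ∫ x : E n, ⟪annTilde m x Φ,
          ((covComp x i : ℝ) : ℂ) • partialDeriv k (fun y => annTilde m y Ψ) x
            - ((covComp x k : ℝ) : ℂ) • partialDeriv i (fun y => annTilde m y Ψ) x⟫_ℂ) := by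
  have : Nonempty (Fin n) := ⟨⟨0, hn⟩⟩
  have : Nontrivial (E n) := inferInstance
  have hm : 0 < m := Fact.out
  refine ⟨fun Ψ => ⟨integrable_ann m Ψ, differentiable_ann m Ψ, differentiable_annTilde m Ψ⟩,
    existsUnique_boostGenerator m, existsUnique_rotationGenerator m, fun φ => ?_,
    fun j M hM Φ Ψ => ?_, fun i k M hM Φ Ψ => ?_⟩
  · exact ⟨fun ε hε => integrableOn_omegaTilde_mul_schwartz hm φ hε,
      integrable_omega_mul_integral_exp_mul m φ, hasFinitePart_omegaTilde_mul_schwartz m φ⟩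
  · exact ⟨fun ε hε => integrableOn_boost_kernel_mul_inner_annTilde j Φ Ψ hε,
      hM.hasFinitePart_inner Φ Ψ⟩
  · exact ⟨integrable_inner_annTilde_rotation i k Φ Ψ, hM.inner_eq_integral_annTilde Φ Ψ⟩
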